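/- Let $\rho=\frac{\sqrt5-1}{2}$, $q_0=(\frac12,\frac{\sqrt3}{2})$, $q_1=(0,0)$, $q_2=(1,0)$, $V_0=\{q_0,q_1,q_2\}$, and let $F_0(x)=\rho^2(x-q_0)+q_0$, $F_1(x)=\rho(x-q_1)+q_1$, $F_2(x)=\rho(x-q_2)+q_2$ on $\mathbb R^2$. For a word $w=w_1\cdots w_m$ write $|w|=m$ and $F_w=F_{w_1}\circ\cdots\circ F_{w_m}$. Let $W_1\subset\bigcup_{n\ge0}\{1,2\}^n\times\{0\}$ contain exactly one word for each of the maps $F_w$ with $w\in\bigcup_{n\ge0}\{1,2\}^n\times\{0\}$, and put $V_1=\bigcup_{w\in W_1}F_wV_0$, with closure $\bar V_1$; one has $V_0\subset\bar V_1$. Recall that a (non-degenerate) resistance form $(\mathcal E,\mathcal F)$ on a set $X$ consists of a linear space $\mathcal F$ of real functions on $X$ containing the constants and a nonnegative symmetric bilinear form $\mathcal E$ on $\mathcal F$, with $\mathcal E(f):=\mathcal E(f,f)$, such that: $\mathcal E(f)=0$ if and only if $f$ is constant; $(\mathcal F/\text{constants},\mathcal E)$ is complete; every real function on a finite subset of $X$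 extends to an element of $\mathcal F$; $\sup\{|f(p)-f(q)|^2/\mathcal E(f):f\in\mathcal F,\ \mathcal E(f)>0\}<\infty$ for all $p\ne q$ in $X$; and $\bar f=\min\{\max\{f,0\},1\}\in\mathcal F$ with $\mathcal E(\bar f)\le\mathcal E(f)$ for every $f\in\mathcal F$. Let $\mathcal M$ be the set of all resistance forms $\mathcal D$ on $V_0$, viewed as a subset of $\mathbb R^3$ through the coefficients $(a_{0,1},a_{0,2},a_{1,2})$ in $\mathcal D(f,g)=\sum_{i<j}a_{i,j}(f(q_i)-f(q_j))(g(q_i)-g(q_j))$. For $r>0$ and $\mathcal D\in\mathcal M$ let $$\Psi_r\mathcal D(f,g)=\sum_{w\in W_1}r^{-|w|+1}\mathcal D(f\circ F_w,g\circ F_w),\qquad \mathrm{Dom}(\Psi_r\mathcal D)=\{f:V_1\to\mathbb R:\ \Psi_r\mathcal D(f,f)<\infty\}.$$ Theorem. For all $\rho<r<1$ and $\mathcal D\in\mathcal M$, every $f\in\mathrm{Dom}(\Psi_r\mathcal D)$ extends uniquely to a continuous function on $\bar V_1$, and with this identification $\Psi_r\mathcal D$ is a resistance form on $\bar V_1$.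 Its trace $$\mathcal R_r\mathcal D(u)=[\Psi_r\mathcal D]_{V_0}(u)=\inf\{\Psi_r\mathcal D(f,f):\ f\in\mathrm{Dom}(\Psi_r\mathcal D),\ f|_{V_0}=u\},\qquad u:V_0\to\mathbb R,$$ is (the quadratic form of) a resistance form on $V_0$, and the map $(r,\mathcal D)\mapsto\mathcal R_r\mathcal D$ is jointly continuous from $(\rho,1)\times\mathcal M$ to $\mathcal M$. -/

import Mathlib

open Set Filter Topology

noncomputable section

namespace GoldenGasket

/-- A pair `(E, F)` is a (non-degenerate) resistance form on `X`. The values of `E` outside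
`F × F` are irrelevant. -/
structure IsResistanceForm {X : Type*} (F : Set (X → ℝ)) (E : (X → ℝ) → (X → ℝ) → ℝ) :
    Prop where
  /-- (RF1) `F` is a linear subspace of `l(X)` containing the constants. -/
  const_mem : ∀ c : ℝ, (fun _ => c) ∈ F
  add_mem : ∀ f ∈ F, ∀ g ∈ F, f + g ∈ F
  smul_mem : ∀ c : ℝ, ∀ f ∈ F, c • f ∈ F
  /-- (RF1) `E` is a nonnegative symmetric bilinear form on `F`, with kernel the constants. -/
  symm : ∀ f ∈ F, ∀ g ∈ F, E f g = E g f
  add_left : ∀ f ∈ F, ∀ g ∈ F, ∀ h ∈ F, E (f + g) h = E f h + E g h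
  smul_left : ∀ c : ℝ, ∀ f ∈ F, ∀ g ∈ F, E (c • f) g = c * E f g
  nonneg : ∀ f ∈ F, 0 ≤ E f f
  eq_zero_iff : ∀ f ∈ F, (E f f = 0 ↔ ∃ c : ℝ, ∀ x, f x = c)
  /-- (RF2) `F` modulo constants is complete for the inner product `E`. -/
  complete : ∀ f : ℕ → X → ℝ, (∀ n, f n ∈ F) →
    (∀ ε > 0, ∃ N, ∀ m ≥ N, ∀ n ≥ N, E (f m - f n) (f m - f n) < ε) →
    ∃ g ∈ F, Tendsto (fun n => E (f n - g) (f n - g)) atTop (𝓝 0)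
  /-- (RF3) Every function on a finite subset is the restriction of an element of `F`. -/
  exists_extension : ∀ (V : Finset X) (u : X → ℝ), ∃ f ∈ F, ∀ x ∈ V, f x = u x
  /-- (RF4) The effective resistance between distinct points is finite. -/
  resistance_finite : ∀ p q : X, p ≠ q →
    BddAbove {t : ℝ | ∃ f ∈ F, 0 < E f f ∧ t = |f p - f q| ^ 2 / E f f}
  /-- (RF5) The Markov property. -/
  markov : ∀ f ∈ F, (fun x => min (max (f x) 0) 1) ∈ F ∧
    E (fun x => min (max (f x) 0) 1) (fun x => min (max (f x) 0) 1) ≤ E f f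

/-- The Euclidean plane. -/
abbrev Plane : Type := EuclideanSpace ℝ (Fin 2)

/-- `ρ = (√5 - 1) / 2`. -/
def rho : ℝ := (√5 - 1) / 2

/-- The vertices `q₀, q₁, q₂` of the unit equilateral triangle; `V₀ = {q₀, q₁, q₂}`. Functions on
`V₀` are written as functions of the index `i : Fin 3`. -/
def q : Fin 3 → Plane := ![!₂[1 / 2, √3 / 2], !₂[0, 0], !₂[1, 0]]

/-- The contraction ratios `ρ², ρ, ρ`. -/
def ratio : Fin 3 → ℝ := ![rho ^ 2, rho, rho]

/-- The maps `F₀, F₁, F₂`. -/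
def F (i : Fin 3) (x : Plane) : Plane := ratio i • (x - q i) + q i

/-- `F_w = F_{w₁} ∘ ⋯ ∘ F_{w_m}` for a word `w = w₁ ⋯ w_m`. -/
def Fw : List (Fin 3) → Plane → Plane
  | [] => id
  | i :: w => F i ∘ Fw w

/-- The words of `⋃ₙ {1,2}ⁿ × {0}`. -/
def baseWords : Set (List (Fin 3)) :=
  {w | ∃ v : List (Fin 3), (∀ i ∈ v, i = 1 ∨ i = 2) ∧ w = v ++ [0]}

/-- A choice of the set `W₁` of words: it contains exactly one word for each of the maps `F_w`,
`w ∈ ⋃ₙ {1,2}ⁿ × {0}`. -/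
structure CellWords where
  words : Set (List (Fin 3))
  subset_base : words ⊆ baseWords
  exists_rep : ∀ w ∈ baseWords, ∃ w' ∈ words, Fw w = Fw w'
  distinct : ∀ w ∈ words, ∀ w' ∈ words, w ≠ w' → Fw w ≠ Fw w'

/-- `V₁ = ⋃_{w ∈ W₁} F_w V₀`. -/
def V1 (W : CellWords) : Set Plane := ⋃ w ∈ W.words, Fw w '' range q

theorem Fw_q_mem_V1 (W : CellWords) (w : W.words) (i : Fin 3) : Fw w (q i) ∈ V1 W :=
  mem_biUnion w.2 (mem_image_of_mem _ (mem_range_self i))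

theorem F_zero_q_zero : F 0 (q 0) = q 0 := by simp [F]

theorem Fw_replicate (i : Fin 3) (n : ℕ) :
    Fw (List.replicate n i ++ [0]) (q 0) = ratio i ^ n • (q 0 - q i) + q i := by
  induction n with
  | zero => simp [Fw, F_zero_q_zero]
  | succ n ih =>
    rw [List.replicate_succ, List.cons_append, Fw, Function.comp_apply, ih, F,
      add_sub_cancel_right, smul_smul, pow_succ']

theorem rho_pos : 0 < rho := by
  have : (1 : ℝ) < √5 := by
    rw [Real.lt_sqrt] <;> norm_num
  unfold rho; linarith

theorem rho_lt_one : rho < 1 := by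
  have : √5 < (3 : ℝ) := by
    rw [Real.sqrt_lt'] <;> norm_num
  unfold rho; linarith

/-- `V₀` is contained in the closure of `V₁` (although `q₁, q₂` do not lie in `V₁`). -/
theorem q_mem_closure (W : CellWords) (i : Fin 3) : q i ∈ closure (V1 W) := by
  have key : ∀ v : List (Fin 3), (∀ j ∈ v, j = 1 ∨ j = 2) → Fw (v ++ [0]) (q 0) ∈ V1 W := by
    intro v hv
    obtain ⟨w', hw', h⟩ := W.exists_rep (v ++ [0]) ⟨v, hv, rfl⟩
    rw [h]
    exact Fw_q_mem_V1 W ⟨w', hw'⟩ 0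
  by_cases hi : i = 0
  · subst hi
    apply subset_closure
    simpa [Fw, F_zero_q_zero] using key [] (by simp)
  · have hi' : i = 1 ∨ i = 2 := by omega
    have hr : ratio i = rho := by rcases hi' with rfl | rfl <;> simp [ratio]
    have hlim : Tendsto (fun n : ℕ => rho ^ n • (q 0 - q i) + q i) atTop (𝓝 (q i)) := by
      have h0 := tendsto_pow_atTop_nhds_zero_of_lt_one rho_pos.le rho_lt_one
      simpa using (h0.smul_const (q 0 - q i)).add_const (q i)
    refine mem_closure_of_tendsto hlim (Eventually.of_forall fun n => ?_)
    have h := key (List.replicate n i) (fun j hj => by rw [List.eq_of_mem_replicate hj]; exact hi')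
    rwa [Fw_replicate, hr] at h

/-- The set `𝓜` of all resistance forms `𝓓` on `V₀`. By (RF3) the domain of a resistance form on
the finite set `V₀` consists of all functions on `V₀`. -/
@[ext]
structure FormsV0 where
  form : (Fin 3 → ℝ) → (Fin 3 → ℝ) → ℝ
  isResistanceForm : IsResistanceForm univ form

/-- The conductances `(a₀₁, a₀₂, a₁₂) ∈ ℝ³` of a resistance form on `V₀`:
`a_{ij} = -𝓓(1_{qᵢ}, 1_{qⱼ})`. -/
def FormsV0.coeff (D : FormsV0) : Fin 3 → ℝ :=
  ![-D.form (Pi.single 0 1) (Pi.single 1 1), -D.form (Pi.single 0 1) (Pi.single 2 1),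
    -D.form (Pi.single 1 1) (Pi.single 2 1)]

/-- `𝓓(f,g) = ½ ∑ a_{ij} (f(qᵢ) - f(qⱼ)) (g(qᵢ) - g(qⱼ))`; in particular the conductances
determine the form, so that they identify `𝓜` with a subset of `ℝ³`. -/
theorem FormsV0.form_eq (D : FormsV0) (f g : Fin 3 → ℝ) :
    D.form f g = D.coeff 0 * (f 0 - f 1) * (g 0 - g 1) + D.coeff 1 * (f 0 - f 2) * (g 0 - g 2)
      + D.coeff 2 * (f 1 - f 2) * (g 1 - g 2) := by
  have h := D.isResistanceForm
  have hd : ∀ f : Fin 3 → ℝ,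
      f = f 0 • Pi.single 0 1 + (f 1 • Pi.single 1 1 + f 2 • Pi.single 2 1) := by
    intro f; ext i; fin_cases i <;> simp
  have expand : ∀ a b : Fin 3 → ℝ, D.form a b = a 0 * D.form (Pi.single 0 1) b
      + (a 1 * D.form (Pi.single 1 1) b + a 2 * D.form (Pi.single 2 1) b) := by
    intro a b
    conv_lhs => rw [hd a]
    rw [h.add_left _ trivial _ trivial _ trivial, h.add_left _ trivial _ trivial _ trivial,
      h.smul_left _ _ trivial _ trivial, h.smul_left _ _ trivial _ trivial,
      h.smul_left _ _ trivial _ trivial]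
  have one : ∀ b : Fin 3 → ℝ, D.form (fun _ => 1) b = 0 := by
    intro b
    have h0 : D.form (fun _ => 1) (fun _ => 1) = 0 :=
      (h.eq_zero_iff _ trivial).2 ⟨1, fun _ => rfl⟩
    have hq : ∀ t : ℝ, 0 ≤ 2 * t * D.form (fun _ => 1) b + D.form b b := by
      intro t
      have h1 := h.nonneg (t • (fun _ => 1) + b) trivial
      rw [h.add_left _ trivial _ trivial _ trivial, h.smul_left _ _ trivial _ trivial,
        h.symm _ trivial (t • (fun _ => 1) + b) trivial, h.symm b trivial _ trivial,
        h.add_left _ trivial _ trivial _ trivial, h.add_left _ trivial _ trivial _ trivial,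
        h.smul_left _ _ trivial _ trivial, h.smul_left _ _ trivial _ trivial, h0,
        h.symm b trivial _ trivial] at h1
      linarith
    by_contra hne
    have h2 := hq (-(D.form b b + 1) / (2 * D.form (fun _ => 1) b))
    have h3 : 2 * (-(D.form b b + 1) / (2 * D.form (fun _ => 1) b)) * D.form (fun _ => 1) b
        = -(D.form b b + 1) := by field_simp
    linarith
  have e0 := one (Pi.single 0 1)
  have e1 := one (Pi.single 1 1)
  have e2 := one (Pi.single 2 1)
  rw [expand] at e0 e1 e2
  rw [expand f g, h.symm _ trivial g trivial, h.symm _ trivial g trivial,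
    h.symm _ trivial g trivial, expand g, expand g, expand g]
  simp only [FormsV0.coeff, Matrix.cons_val]
  have s1 := h.symm (Pi.single 0 1) trivial (Pi.single 1 1) trivial
  have s2 := h.symm (Pi.single 0 1) trivial (Pi.single 2 1) trivial
  have s3 := h.symm (Pi.single 1 1) trivial (Pi.single 2 1) trivial
  linear_combination f 0 * g 0 * e0 + f 1 * g 1 * e1 + f 2 * g 2 * e2
    + (f 0 * g 0 - f 0 * g 1) * s1 + (f 0 * g 0 - f 0 * g 2) * s2 + (f 1 * g 1 - f 1 * g 2) * s3

/-- `𝓜` carries the topology induced from `ℝ³`. -/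
instance : TopologicalSpace FormsV0 := TopologicalSpace.induced FormsV0.coeff inferInstance

/-- `f ∘ F_w` as a function on `V₀`, for `f` a function on `V₁` and `w ∈ W₁`. -/
def cell (W : CellWords) (f : V1 W → ℝ) (w : W.words) : Fin 3 → ℝ :=
  fun i => f ⟨Fw w (q i), Fw_q_mem_V1 W w i⟩

/-- The summand `r^{-|w|+1} 𝓓(f ∘ F_w, g ∘ F_w)` of `Ψ_r 𝓓(f,g)`. -/
def psiTerm (W : CellWords) (r : ℝ) (D : FormsV0) (f g : V1 W → ℝ) (w : W.words) : ℝ :=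
  r ^ (-((w : List (Fin 3)).length : ℤ) + 1) * D.form (cell W f w) (cell W g w)

/-- `Dom(Ψ_r 𝓓) = {f ∈ l(V₁) : Ψ_r 𝓓(f) < ∞}` (a series of nonnegative terms). -/
def psiDom (W : CellWords) (r : ℝ) (D : FormsV0) : Set (V1 W → ℝ) :=
  {f | Summable (psiTerm W r D f f)}

/-- `Ψ_r 𝓓(f,g) = ∑_{w ∈ W₁} r^{-|w|+1} 𝓓(f ∘ F_w, g ∘ F_w)`. -/
def psi (W : CellWords) (r : ℝ) (D : FormsV0) (f g : V1 W → ℝ) : ℝ :=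
  ∑' w, psiTerm W r D f g w

/-- The closure of `V₁`. -/
abbrev V1bar (W : CellWords) : Type := ↥(closure (V1 W))

/-- Restriction of functions from the closure of `V₁` to `V₁`. -/
def res (W : CellWords) (f : V1bar W → ℝ) : V1 W → ℝ := fun x => f ⟨x, subset_closure x.2⟩

/-- The domain of `Ψ_r 𝓓` as a form on the closure of `V₁`: the continuous functions whose
restriction to `V₁` lies in `Dom(Ψ_r 𝓓)`. -/
def psiBarDom (W : CellWords) (r : ℝ) (D : FormsV0) : Set (V1bar W → ℝ) :=
  {f | Continuous f ∧ res W f ∈ psiDom W r D}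

/-- `Ψ_r 𝓓` as a form on the closure of `V₁`. -/
def psiBar (W : CellWords) (r : ℝ) (D : FormsV0) (f g : V1bar W → ℝ) : ℝ :=
  psi W r D (res W f) (res W g)

/-- The trace `[E]_{V₀}(u) = inf {E(f) : f ∈ G, f|_{V₀} = u}` of a form `(E, G)` on the closure
of `V₁`. -/
def traceV0 (W : CellWords) (G : Set (V1bar W → ℝ)) (E : (V1bar W → ℝ) → (V1bar W → ℝ) → ℝ)
    (u : Fin 3 → ℝ) : ℝ :=
  sInf {t : ℝ | ∃ f ∈ G, (∀ i, f ⟨q i, q_mem_closure W i⟩ = u i) ∧ t = E f f}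

end GoldenGasket

end

open GoldenGasket

noncomputable section

namespace GoldenGasket

/-! ### Left ends of the cells of a given level -/

section

/-! A map `F_v` with `v ∈ {1,2}ⁿ` is `x ↦ ρⁿ x + p q₂`, so the cells of `V₁` are indexed by a level
`n` and a left end `p ∈ leftEnds n`. Since `ρ² = 1 - ρ`, distinct words may give the same map, but
neighbouring left ends of level `n` are always at distance `ρ^(n+2)` or `ρ^(n+1)`. A form on `V₀` is
comparable to `sqForm`, so the energy is comparable to `∑ r⁻ⁿ levelSq n`.

The resistance form. A cell of level `n` carries at most the total energy, so along its edges the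
function varies by at most `B √r ^ n` (`childBound_of_psi_le`). Chaining through ancestors and
neighbours gives uniform continuity and an oscillation bound (`ChildBound.uniformContinuous`,
`ChildBound.abs_sub_le`); this uses `r < 1`. Completeness then follows from lower semicontinuity of
the energy (`psi_le_of_tendsto`). Lipschitz functions have `levelSq n = O(ρⁿ)`, hence finite energy
because `ρ < r`; they provide extensions from finite sets. The trace on a finite set is a resistance
form by the general argument with harmonic extensions (`exists_trace`).

Continuity. The domain may change with `r`, so the trace is computed on the core of functions with
finite energy for every parameter. A function of finite energy is approximated by keeping its values
down to level `N` and interpolating linearly in the left end at deeper levels; the interpolation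
loses a factor `ρ` per level (`sum_sq_interp_le`), so it lies in the core and the error tends to `0`
(`tendsto_psi_smoothing_sub`). On the core the energy is continuous in `(r, 𝓓)` by dominated
convergence, which makes the trace upper semicontinuous. For lower semicontinuity, near-minimizers
at nearby parameters share one modulus of continuity, so they converge pointwise along an
ultrafilter to a competitor whose energy is no larger. Polarization passes from the quadratic forms
to the conductances. -/

theorem rho_sq : rho ^ 2 = 1 - rho := by
  have h : √5 ^ 2 = (5 : ℝ) := Real.sq_sqrt (by norm_num)
  unfold rho
  linear_combination h / 4

theorem rho_pow_add_two (n : ℕ) : rho ^ (n + 2) = rho ^ n - rho ^ (n + 1) := by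
  rw [pow_add, rho_sq]; ring

theorem rho_pow_pos (n : ℕ) : 0 < rho ^ n := pow_pos rho_pos n

theorem rho_pow_succ_lt (n : ℕ) : rho ^ (n + 1) < rho ^ n :=
  pow_lt_pow_right_of_lt_one₀ rho_pos rho_lt_one (Nat.lt_succ_self n)

/-- The left ends of the bases of the triangles `F_v (conv V₀)`, `v ∈ {1,2}ⁿ`. -/
def leftEnds : ℕ → Finset ℝ
  | 0 => {0}
  | n + 1 => leftEnds n ∪ (leftEnds n).image (· + rho ^ (n + 2))

theorem mem_leftEnds_succ {n : ℕ} {x : ℝ} :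
    x ∈ leftEnds (n + 1) ↔ x ∈ leftEnds n ∨ ∃ y ∈ leftEnds n, y + rho ^ (n + 2) = x := by
  simp only [leftEnds, Finset.mem_union, Finset.mem_image]

theorem leftEnds_subset_succ {n : ℕ} {x : ℝ} (hx : x ∈ leftEnds n) : x ∈ leftEnds (n + 1) :=
  mem_leftEnds_succ.2 (Or.inl hx)

theorem add_mem_leftEnds_succ {n : ℕ} {x : ℝ} (hx : x ∈ leftEnds n) :
    x + rho ^ (n + 2) ∈ leftEnds (n + 1) :=
  mem_leftEnds_succ.2 (Or.inr ⟨x, hx, rfl⟩)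

theorem zero_mem_leftEnds (n : ℕ) : (0 : ℝ) ∈ leftEnds n := by
  induction n with
  | zero => simp [leftEnds]
  | succ n ih => exact leftEnds_subset_succ ih

theorem last_mem_leftEnds (n : ℕ) : 1 - rho ^ n ∈ leftEnds n := by
  induction n with
  | zero => simp [leftEnds]
  | succ n ih =>
    have := add_mem_leftEnds_succ ih
    rwa [rho_pow_add_two, show 1 - rho ^ n + (rho ^ n - rho ^ (n + 1)) = 1 - rho ^ (n + 1) by ring]
      at this

theorem leftEnds_nonneg {n : ℕ} {x : ℝ} (hx : x ∈ leftEnds n) : 0 ≤ x := by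
  induction n generalizing x with
  | zero => simp [leftEnds] at hx; simp [hx]
  | succ n ih =>
    rcases mem_leftEnds_succ.1 hx with h | ⟨y, h, rfl⟩
    · exact ih h
    · have := ih h
      have := rho_pow_pos (n + 2)
      linarith

theorem leftEnds_le {n : ℕ} {x : ℝ} (hx : x ∈ leftEnds n) : x ≤ 1 - rho ^ n := by
  induction n generalizing x with
  | zero => simp [leftEnds] at hx; simp [hx]
  | succ n ih =>
    have h2 := rho_pow_add_two n
    have h3 := rho_pow_succ_lt n
    rcases mem_leftEnds_succ.1 hx with h | ⟨y, h, rfl⟩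
    · have := ih h
      linarith
    · have := ih h
      linarith

/-- A difference at level `n + 1` is one at level `n` changed by `0` or `±ρ^(n+2)`. With `ρ^n =
ρ^(n+1) + ρ^(n+2)` the three alternatives reproduce themselves, and the last one absorbs all larger
distances. -/
theorem leftEnds_separated {n : ℕ} {x y : ℝ} (hx : x ∈ leftEnds n) (hy : y ∈ leftEnds n)
    (hxy : x < y) : y - x = rho ^ (n + 2) ∨ y - x = rho ^ (n + 1) ∨ rho ^ n ≤ y - x := by
  induction n generalizing x y with
  | zero => simp [leftEnds] at hx hy; simp [hx, hy] at hxy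
  | succ n ih =>
    have h2 := rho_pow_add_two n
    have h3 := rho_pow_add_two (n + 1)
    have h4 := rho_pow_succ_lt n
    have h5 := rho_pow_pos (n + 3)
    have h6 := rho_pow_succ_lt (n + 2)
    simp only [add_assoc, Nat.reduceAdd] at h3 h6 ⊢
    have key : ∀ x ∈ leftEnds n, ∀ y ∈ leftEnds n, x < y → rho ^ (n + 2) ≤ y - x := by
      intro x hx y hy hxy
      rcases ih hx hy hxy with h | h | h <;> linarith
    rcases mem_leftEnds_succ.1 hx with h | ⟨x, h, rfl⟩ <;>
    rcases mem_leftEnds_succ.1 hy with h' | ⟨y, h', rfl⟩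
    · rcases ih h h' hxy with h | h | h
      · right; left; linarith
      · right; right; linarith
      · right; right; linarith
    · rcases lt_trichotomy x y with hlt | rfl | hlt
      · have := key _ h _ h' hlt
        right; right; linarith
      · right; left; ring
      · have := key _ h' _ h hlt
        linarith
    · rcases lt_trichotomy x y with hlt | rfl | hlt
      · rcases ih h h' hlt with h | h | h
        · linarith
        · left; linarith
        · right; right; linarith
      · linarith
      · linarith
    · rcases ih h h' (by linarith) with h | h | h
      · right; left; linarith
      · right; right; linarith
      · right; right; linarith

theorem leftEnds_add_le {n : ℕ} {x y : ℝ} (hx : x ∈ leftEnds n) (hy : y ∈ leftEnds n)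
    (hxy : x < y) : x + rho ^ (n + 2) ≤ y := by
  have h2 := rho_pow_add_two n
  have h4 := rho_pow_succ_lt (n + 1)
  have h5 := rho_pow_pos (n + 1)
  rcases leftEnds_separated hx hy hxy with h | h | h <;> simp only [add_assoc, Nat.reduceAdd] at h4 <;>
    linarith

theorem leftEnds_next {n : ℕ} {x : ℝ} (hx : x ∈ leftEnds n) :
    x = 1 - rho ^ n ∨ x + rho ^ (n + 2) ∈ leftEnds n ∨ x + rho ^ (n + 1) ∈ leftEnds n := by
  induction n generalizing x with
  | zero => simp [leftEnds] at hx; simp [hx]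
  | succ n ih =>
    rcases mem_leftEnds_succ.1 hx with h | ⟨y, h, rfl⟩
    · exact Or.inr (Or.inr (add_mem_leftEnds_succ h))
    · rcases ih h with rfl | h1 | h1
      · left; rw [rho_pow_add_two]; ring
      · exact Or.inr (Or.inr (add_mem_leftEnds_succ h1))
      · right; left
        rw [show y + rho ^ (n + 2) + rho ^ (n + 1 + 2) = y + rho ^ (n + 1) by
          rw [rho_pow_add_two (n + 1)]; ring]
        exact leftEnds_subset_succ h1

/-- The distance from `x` to the next element of `leftEnds n`. -/
def gap (n : ℕ) (x : ℝ) : ℝ := if x + rho ^ (n + 2) ∈ leftEnds n then rho ^ (n + 2) else rho ^ (n + 1)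

theorem le_gap (n : ℕ) (x : ℝ) : rho ^ (n + 2) ≤ gap n x := by
  unfold gap
  split_ifs
  · rfl
  · exact (rho_pow_succ_lt (n + 1)).le

theorem gap_pos (n : ℕ) (x : ℝ) : 0 < gap n x := (rho_pow_pos _).trans_le (le_gap n x)

theorem add_gap_mem {n : ℕ} {x : ℝ} (hx : x ∈ leftEnds n) (hl : x ≠ 1 - rho ^ n) :
    x + gap n x ∈ leftEnds n := by
  unfold gap
  split_ifs with h
  · exact h
  · exact ((leftEnds_next hx).resolve_left hl).resolve_left h

theorem add_gap_le {n : ℕ} {x y : ℝ} (hx : x ∈ leftEnds n) (hy : y ∈ leftEnds n)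
    (hxy : x < y) : x + gap n x ≤ y := by
  unfold gap
  split_ifs with h
  · exact leftEnds_add_le hx hy hxy
  · rcases leftEnds_separated hx hy hxy with h1 | h1 | h1
    · exact absurd (by rwa [← h1, add_sub_cancel]) h
    · linarith
    · have := rho_pow_succ_lt n
      linarith

/-- Induction from neighbour to neighbour, from left to right: the greatest left end below a least
counterexample satisfies the motive, and one gap leads from it to the counterexample. -/
theorem leftEnds_induction {n : ℕ} {x : ℝ} (hx : x ∈ leftEnds n) {motive : ℝ → Prop}
    (base : motive x)
    (step : ∀ y ∈ leftEnds n, x ≤ y → y ≠ 1 - rho ^ n → motive y → motive (y + gap n y)) :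
    ∀ y ∈ leftEnds n, x ≤ y → motive y := by
  classical
  by_contra! hne
  obtain ⟨y₀, hy₀, hxy₀, hm₀⟩ := hne
  obtain ⟨y, hy, hmin⟩ := Finset.exists_min_image
    {y ∈ leftEnds n | x ≤ y ∧ ¬ motive y} id ⟨y₀, by simp [hy₀, hxy₀, hm₀]⟩
  simp only [Finset.mem_filter, id] at hy hmin
  obtain ⟨hy, hxy, hm⟩ := hy
  have hlt : x < y := lt_of_le_of_ne hxy (by rintro rfl; exact hm base)
  obtain ⟨z, hz, hmax⟩ := Finset.exists_max_image
    {z ∈ leftEnds n | x ≤ z ∧ z < y} id ⟨x, by simp [hx, hlt]⟩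
  simp only [Finset.mem_filter, id] at hz hmax
  obtain ⟨hz, hxz, hzy⟩ := hz
  have hzl : z ≠ 1 - rho ^ n := by
    have := leftEnds_le hy
    intro h
    linarith
  have hg := gap_pos n z
  have hzm : motive z := by
    by_contra hc
    have := hmin z ⟨hz, hxz, hc⟩
    linarith
  have h1 := add_gap_le hz hy hzy
  rcases h1.eq_or_lt with h1 | h1
  · exact hm (h1 ▸ step z hz hxz hzl hzm)
  · have := hmax _ ⟨add_gap_mem hz hzl, by linarith, h1⟩
    linarith

/-! ### Piecewise linear interpolation in the left end -/

/-- The total increment of a monotone function over nonoverlapping intervals. -/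
theorem sum_increment_le (S : Finset ℝ) (g : ℝ → ℝ)
    (hS : ∀ x ∈ S, ∀ y ∈ S, x < y → x + g x ≤ y) {K : ℝ → ℝ} (hK : Monotone K) {A : ℝ} :
    ∀ b, A ≤ K b → (∀ x ∈ S, A ≤ K x) → (∀ x ∈ S, x + g x ≤ b) →
      ∑ x ∈ S, (K (x + g x) - K x) ≤ K b - A := by
  induction S using Finset.induction_on_max with
  | empty => intro b hb _ _; simpa using hb
  | insert a s ha ih =>
    intro b _ hA hb
    rw [Finset.sum_insert (fun h => lt_irrefl _ (ha a h))]
    have h1 := ih (fun x hx y hy => hS x (Finset.mem_insert_of_mem hx) y (Finset.mem_insert_of_mem hy))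
      a (hA a (Finset.mem_insert_self _ _)) (fun x hx => hA x (Finset.mem_insert_of_mem hx))
      (fun x hx => hS x (Finset.mem_insert_of_mem hx) a (Finset.mem_insert_self _ _) (ha x hx))
    have h2 := hK (hb a (Finset.mem_insert_self _ _))
    linarith

/-- The continuous function that is `0` left of `a`, `1` right of `a + g` and linear between. -/
def ramp (a g t : ℝ) : ℝ := (min (max t a) (a + g) - a) / g

theorem ramp_of_le {a g t : ℝ} (hg : 0 < g) (h : t ≤ a) : ramp a g t = 0 := by
  rw [ramp, max_eq_right h, min_eq_left (by linarith), sub_self, zero_div]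

theorem ramp_of_ge {a g t : ℝ} (hg : 0 < g) (h : a + g ≤ t) : ramp a g t = 1 := by
  rw [ramp, max_eq_left (by linarith), min_eq_right h, add_sub_cancel_left, div_self hg.ne']

theorem ramp_mono {a g : ℝ} (hg : 0 < g) : Monotone (ramp a g) := by
  intro s t h
  unfold ramp
  gcongr

theorem ramp_nonneg {a g : ℝ} (hg : 0 < g) (t : ℝ) : 0 ≤ ramp a g t := by
  rw [← ramp_of_le hg (min_le_right t a)]
  exact ramp_mono hg (min_le_left t a)

theorem ramp_le_one {a g : ℝ} (hg : 0 < g) (t : ℝ) : ramp a g t ≤ 1 := by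
  rw [← ramp_of_ge hg (le_max_right t (a + g))]
  exact ramp_mono hg (le_max_left t (a + g))

/-- Both sides are the length of the overlap of `[a, b]` and `[t, t']`, seen once as an increment
over `[t, t']` and once over `[a, b]`. -/
theorem clamp_sub_clamp {a b t t' : ℝ} (hab : a ≤ b) (ht : t ≤ t') :
    min (max t' a) b - min (max t a) b = min (max b t) t' - min (max a t) t' := by
  grind

/-- Increments of functions on `leftEnds n` between neighbours. -/
def inc (n : ℕ) (v : ℝ → ℝ) (x : ℝ) : ℝ := v (x + gap n x) - v x

/-- The piecewise linear interpolation of the restriction of `v` to `leftEnds n`. -/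
def interp (n : ℕ) (v : ℝ → ℝ) (t : ℝ) : ℝ :=
  v 0 + ∑ x ∈ (leftEnds n).erase (1 - rho ^ n), inc n v x * ramp x (gap n x) t

/-- Between `y` and its right neighbour only the ramp based at `y` moves, and it rises from `0` to
`1`. -/
theorem interp_eq {n : ℕ} (v : ℝ → ℝ) {x : ℝ} (hx : x ∈ leftEnds n) : interp n v x = v x := by
  refine leftEnds_induction (zero_mem_leftEnds n) (motive := fun x => interp n v x = v x) ?_ ?_ x hx (leftEnds_nonneg hx)
  · rw [interp, Finset.sum_eq_zero, add_zero]
    intro x hx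
    rw [ramp_of_le (gap_pos n x) (leftEnds_nonneg (Finset.mem_of_mem_erase hx)), mul_zero]
  · intro y hy _ hl ih
    have hsum : interp n v (y + gap n y) - interp n v y = inc n v y := by
      rw [interp, interp, add_sub_add_left_eq_sub, ← Finset.sum_sub_distrib,
        Finset.sum_eq_single_of_mem y (Finset.mem_erase.2 ⟨hl, hy⟩)]
      · rw [ramp_of_ge (gap_pos n y) le_rfl, ramp_of_le (gap_pos n y) le_rfl]; ring
      · intro x hx hne
        have hx' := Finset.mem_of_mem_erase hx
        have hg := gap_pos n y
        rcases lt_or_gt_of_ne hne with h | h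
        · have h1 := add_gap_le hx' hy h
          rw [ramp_of_ge (gap_pos n x) h1, ramp_of_ge (gap_pos n x) (by linarith), sub_self]
        · have h1 := add_gap_le hy hx' h
          rw [ramp_of_le (gap_pos n x) h1, ramp_of_le (gap_pos n x) h.le, sub_self]
    rw [ih, inc] at hsum
    linarith

/-- The intervals `[x, x + gap n x]` do not overlap, so their traces on `[t, t']` have total length
at most `t' - t`; each ramp has slope at most `1 / ρ^(n+2)`. -/
theorem sum_ramp_le (n : ℕ) {t t' : ℝ} (h : t ≤ t') :
    ∑ x ∈ (leftEnds n).erase (1 - rho ^ n), (ramp x (gap n x) t' - ramp x (gap n x) t) ≤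
      (t' - t) / rho ^ (n + 2) := by
  have hK : Monotone fun s => min (max s t) t' := fun a b hab => by
    dsimp only
    gcongr
  have key := sum_increment_le ((leftEnds n).erase (1 - rho ^ n)) (gap n)
    (fun x hx y hy hxy => add_gap_le (Finset.mem_of_mem_erase hx) (Finset.mem_of_mem_erase hy) hxy)
    hK (A := t) (max t' 1) (by simp [h]) (by simp [h])
    (fun x hx => le_max_of_le_right (by
      rw [Finset.mem_erase] at hx
      have := leftEnds_le (add_gap_mem hx.2 hx.1)
      have := rho_pow_pos n
      linarith))
  have h1 : min (max (max t' 1) t) t' = t' := min_eq_right (by simp)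
  rw [h1] at key
  refine le_trans ?_ (div_le_div_of_nonneg_right key (rho_pow_pos (n + 2)).le)
  rw [Finset.sum_div]
  refine Finset.sum_le_sum fun x _ => ?_
  have hg := gap_pos n x
  rw [← clamp_sub_clamp (by linarith) h, ramp, ramp, ← sub_div, sub_sub_sub_cancel_right]
  exact div_le_div_of_nonneg_left (sub_nonneg.2 (by gcongr)) (rho_pow_pos _) (le_gap n x)

/-- Cauchy–Schwarz with the ramp increments as weights. -/
theorem sq_interp_sub_le (n : ℕ) (v : ℝ → ℝ) {t t' : ℝ} (h : t ≤ t') :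
    (interp n v t' - interp n v t) ^ 2 ≤ (t' - t) / rho ^ (n + 2) *
      ∑ x ∈ (leftEnds n).erase (1 - rho ^ n),
        inc n v x ^ 2 * (ramp x (gap n x) t' - ramp x (gap n x) t) := by
  have hr : ∀ x, 0 ≤ ramp x (gap n x) t' - ramp x (gap n x) t :=
    fun x => sub_nonneg.2 (ramp_mono (gap_pos n x) h)
  rw [interp, interp, add_sub_add_left_eq_sub, ← Finset.sum_sub_distrib]
  refine (Finset.sum_sq_le_sum_mul_sum_of_sq_le_mul _ (fun x _ => hr x)
    (fun x _ => mul_nonneg (sq_nonneg (inc n v x)) (hr x)) (fun x _ => le_of_eq (by ring))).trans ?_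
  exact mul_le_mul_of_nonneg_right (sum_ramp_le n h)
    (Finset.sum_nonneg fun x _ => mul_nonneg (sq_nonneg _) (hr x))

/-- After exchanging the sums, each ramp is summed over the nonoverlapping intervals `[p, p +
ρ^(m+2)]`, which gives at most its total rise `1`. The factor `ρ^m / ρ^n` beats the weight `r^(-m)`
exactly when `ρ < r`. -/
theorem sum_sq_interp_le (n m : ℕ) (v : ℝ → ℝ) :
    ∑ p ∈ leftEnds m, (interp n v (p + rho ^ (m + 2)) - interp n v p) ^ 2 ≤
      rho ^ m / rho ^ n * ∑ x ∈ (leftEnds n).erase (1 - rho ^ n), inc n v x ^ 2 := by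
  have hm := rho_pow_pos (m + 2)
  have hc : (rho ^ (m + 2)) / rho ^ (n + 2) = rho ^ m / rho ^ n := by
    rw [pow_add, pow_add]
    exact mul_div_mul_right _ _ (rho_pow_pos 2).ne'
  calc _ ≤ ∑ p ∈ leftEnds m, rho ^ m / rho ^ n * ∑ x ∈ (leftEnds n).erase (1 - rho ^ n),
        inc n v x ^ 2 * (ramp x (gap n x) (p + rho ^ (m + 2)) - ramp x (gap n x) p) := by
        refine Finset.sum_le_sum fun p _ => ?_
        have := sq_interp_sub_le n v (t := p) (t' := p + rho ^ (m + 2)) (by linarith)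
        rwa [add_sub_cancel_left, hc] at this
    _ = rho ^ m / rho ^ n * ∑ x ∈ (leftEnds n).erase (1 - rho ^ n), inc n v x ^ 2 *
        ∑ p ∈ leftEnds m, (ramp x (gap n x) (p + rho ^ (m + 2)) - ramp x (gap n x) p) := by
        rw [← Finset.mul_sum, Finset.sum_comm]
        simp_rw [Finset.mul_sum]
    _ ≤ _ := by
        refine mul_le_mul_of_nonneg_left (Finset.sum_le_sum fun x _ => ?_)
          (div_nonneg (rho_pow_pos _).le (rho_pow_pos _).le)
        refine mul_le_of_le_one_right (sq_nonneg _) ?_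
        have h0 := ramp_nonneg (a := x) (gap_pos n x)
        refine (sum_increment_le (leftEnds m) (fun _ => rho ^ (m + 2))
          (fun a ha b hb hab => leftEnds_add_le ha hb hab) (ramp_mono (gap_pos n x)) (A := 0)
          2 (h0 2) (fun y _ => h0 y) fun y hy => ?_).trans ?_
        · have h1 := leftEnds_le hy
          have h2 := rho_pow_add_two m
          have h3 := rho_pow_pos (m + 1)
          linarith
        · rw [sub_zero]
          exact ramp_le_one (gap_pos n x) 2

theorem sum_rho_pow_le (m : ℕ) : ∑ _p ∈ leftEnds m, rho ^ (m + 2) ≤ 2 := by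
  have h := sum_increment_le (leftEnds m) (fun _ => rho ^ (m + 2))
    (fun a ha b hb hab => leftEnds_add_le ha hb hab) (K := id) monotone_id (A := 0)
    2 (by norm_num) (fun y hy => leftEnds_nonneg hy) (fun y hy => by
      have h1 := leftEnds_le hy
      have h2 := rho_pow_add_two m
      have h3 := rho_pow_pos (m + 1)
      linarith)
  simpa using h

/-! ### Level energies -/

/-- The sum of the squared differences of `v` over the edges of the cell `(n, p)`. -/
def cellSq (v : ℕ → ℝ → ℝ) (n : ℕ) (p : ℝ) : ℝ :=
  (v n p - v (n + 1) p) ^ 2 + (v n p - v (n + 1) (p + rho ^ (n + 2))) ^ 2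
    + (v (n + 1) p - v (n + 1) (p + rho ^ (n + 2))) ^ 2

theorem cellSq_nonneg (v : ℕ → ℝ → ℝ) (n : ℕ) (p : ℝ) : 0 ≤ cellSq v n p := by
  unfold cellSq; positivity

/-- The unweighted energy of `v` on the cells of level `n`. -/
def levelSq (v : ℕ → ℝ → ℝ) (n : ℕ) : ℝ := ∑ p ∈ leftEnds n, cellSq v n p

theorem levelSq_nonneg (v : ℕ → ℝ → ℝ) (n : ℕ) : 0 ≤ levelSq v n :=
  Finset.sum_nonneg fun p _ => cellSq_nonneg v n p

theorem sum_comp_le_levelSq (v : ℕ → ℝ → ℝ) (n : ℕ) {S : Finset ℝ} {φ : ℝ → ℝ}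
    (hφ : ∀ x ∈ S, φ x ∈ leftEnds n) (hi : Set.InjOn φ S) :
    ∑ x ∈ S, cellSq v n (φ x) ≤ levelSq v n := by
  rw [← Finset.sum_image (f := cellSq v n) hi]
  exact Finset.sum_le_sum_of_subset_of_nonneg (Finset.image_subset_iff.2 hφ)
    fun x _ _ => cellSq_nonneg v n x

/-- Neighbours are joined by a path of cell edges. At distance `ρ^(n+2)` they share a child, so two
edges suffice. At distance `ρ^(n+1) = ρ^(n+2) + ρ^(n+3)` the path descends from `x` through two
right children and climbs back through two left children, which makes four edges. -/
theorem sq_inc_le (v : ℕ → ℝ → ℝ) {n : ℕ} {x : ℝ} :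
    inc n (v n) x ^ 2 ≤ 4 * (cellSq v n x + cellSq v n (x + gap n x)
      + cellSq v (n + 1) (x + rho ^ (n + 2)) + cellSq v (n + 1) (x + gap n x)) := by
  unfold inc gap
  split_ifs with h
  · have h1 := cellSq_nonneg v (n + 1) (x + rho ^ (n + 2))
    unfold cellSq at *
    nlinarith [sq_nonneg (v n x - v (n + 1) (x + rho ^ (n + 2)) - (v (n + 1) (x + rho ^ (n + 2))
      - v n (x + rho ^ (n + 2)))), sq_nonneg (v n x - v (n + 1) x),
      sq_nonneg (v (n + 1) x - v (n + 1) (x + rho ^ (n + 2))),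
      sq_nonneg (v n x - v (n + 1) (x + rho ^ (n + 2))),
      sq_nonneg (v n (x + rho ^ (n + 2)) - v (n + 1) (x + rho ^ (n + 2))),
      sq_nonneg (v n (x + rho ^ (n + 2)) - v (n + 1) (x + rho ^ (n + 2) + rho ^ (n + 2))),
      sq_nonneg (v (n + 1) (x + rho ^ (n + 2)) - v (n + 1) (x + rho ^ (n + 2) + rho ^ (n + 2)))]
  · have e : x + rho ^ (n + 2) + rho ^ (n + 1 + 2) = x + rho ^ (n + 1) := by
      rw [rho_pow_add_two (n + 1)]; ring
    unfold cellSq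
    rw [e]
    generalize x + rho ^ (n + 2) = a
    generalize x + rho ^ (n + 1) = b
    have four : ∀ a b c d : ℝ, (a + b + c + d) ^ 2 ≤ 4 * (a ^ 2 + b ^ 2 + c ^ 2 + d ^ 2) := by
      intro a b c d
      nlinarith [sq_nonneg (a - b), sq_nonneg (a - c), sq_nonneg (a - d), sq_nonneg (b - c),
        sq_nonneg (b - d), sq_nonneg (c - d)]
    have h4 := four (v n x - v (n + 1) a) (v (n + 1) a - v (n + 1 + 1) b)
      (-(v (n + 1) b - v (n + 1 + 1) b)) (-(v n b - v (n + 1) b))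
    have e2 : v n x - v (n + 1) a + (v (n + 1) a - v (n + 1 + 1) b)
      + (-(v (n + 1) b - v (n + 1 + 1) b)) + (-(v n b - v (n + 1) b)) = -(v n b - v n x) := by ring
    rw [e2, neg_sq, neg_sq, neg_sq] at h4
    linarith [sq_nonneg (v n x - v (n + 1) x), sq_nonneg (v (n + 1) x - v (n + 1) a),
      sq_nonneg (v n b - v (n + 1) (b + rho ^ (n + 2))),
      sq_nonneg (v (n + 1) b - v (n + 1) (b + rho ^ (n + 2))),
      sq_nonneg (v (n + 1) a - v (n + 1 + 1) a), sq_nonneg (v (n + 1 + 1) a - v (n + 1 + 1) b),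
      sq_nonneg (v (n + 1) b - v (n + 1 + 1) (b + rho ^ (n + 1 + 2))),
      sq_nonneg (v (n + 1 + 1) b - v (n + 1 + 1) (b + rho ^ (n + 1 + 2)))]

/-- The four cells of `sq_inc_le` depend injectively on `x`, two at level `n` and two at level `n +
1`; so each level energy is counted at most twice, with the factor `4`. -/
theorem sum_sq_inc_le (v : ℕ → ℝ → ℝ) (n : ℕ) :
    ∑ x ∈ (leftEnds n).erase (1 - rho ^ n), inc n (v n) x ^ 2 ≤
      8 * (levelSq v n + levelSq v (n + 1)) := by
  have hinj : Set.InjOn (fun x => x + gap n x) ((leftEnds n).erase (1 - rho ^ n) : Finset ℝ) := by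
    intro x hx y hy h
    have hx' := Finset.mem_of_mem_erase (Finset.mem_coe.1 hx)
    have hy' := Finset.mem_of_mem_erase (Finset.mem_coe.1 hy)
    have h1 := gap_pos n x
    have h2 := gap_pos n y
    dsimp only at h
    rcases lt_trichotomy x y with hl | hl | hl
    · have := add_gap_le hx' hy' hl
      linarith
    · exact hl
    · have := add_gap_le hy' hx' hl
      linarith
  have hmem : ∀ x ∈ (leftEnds n).erase (1 - rho ^ n), x + gap n x ∈ leftEnds n :=
    fun x hx => add_gap_mem (Finset.mem_erase.1 hx).2 (Finset.mem_erase.1 hx).1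
  have h1 := sum_comp_le_levelSq v n (S := (leftEnds n).erase (1 - rho ^ n)) (φ := fun x => x)
    (fun x hx => Finset.mem_of_mem_erase hx) (fun x _ y _ h => h)
  have h2 := sum_comp_le_levelSq v n hmem hinj
  have h3 := sum_comp_le_levelSq v (n + 1) (S := (leftEnds n).erase (1 - rho ^ n))
    (φ := fun x => x + rho ^ (n + 2))
    (fun x hx => add_mem_leftEnds_succ (Finset.mem_of_mem_erase hx))
    (fun x _ y _ h => by simpa using h)
  have h4 := sum_comp_le_levelSq v (n + 1) (fun x hx => leftEnds_subset_succ (hmem x hx)) hinj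
  refine (Finset.sum_le_sum fun x _ => sq_inc_le v).trans ?_
  rw [← Finset.mul_sum, Finset.sum_add_distrib, Finset.sum_add_distrib, Finset.sum_add_distrib]
  linarith

/-! ### From geometric decay along edges to a modulus of continuity -/

/-- Geometric decay of the differences of `v` along the edges from a vertex to its children. -/
structure ChildBound (v : ℕ → ℝ → ℝ) (B s : ℝ) : Prop where
  left : ∀ n, ∀ p ∈ leftEnds n, |v n p - v (n + 1) p| ≤ B * s ^ n
  right : ∀ n, ∀ p ∈ leftEnds n, |v n p - v (n + 1) (p + rho ^ (n + 2))| ≤ B * s ^ n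
  s_nonneg : 0 ≤ s
  s_lt_one : s < 1

namespace ChildBound

variable {v : ℕ → ℝ → ℝ} {B s : ℝ}

theorem B_nonneg (h : ChildBound v B s) : 0 ≤ B := by
  simpa using (abs_nonneg _).trans (h.left 0 0 (zero_mem_leftEnds 0))

/-- Each vertex of level `n + k + 1` is a child of one of level `n + k`. The variation along the
chain is a geometric sum, and the displacement telescopes because one step is at most `ρ^(n+k+2) =
ρ^(n+k) - ρ^(n+k+1)`. -/
theorem exists_ancestor (h : ChildBound v B s) (n k : ℕ) {p : ℝ} (hp : p ∈ leftEnds (n + k)) :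
    ∃ a ∈ leftEnds n, a ≤ p ∧ p ≤ a + (rho ^ n - rho ^ (n + k)) ∧
      |v (n + k) p - v n a| ≤ B * (s ^ n - s ^ (n + k)) / (1 - s) := by
  induction k generalizing p with
  | zero => exact ⟨p, hp, le_rfl, by simp, by simp⟩
  | succ k ih =>
    have hs : 0 < 1 - s := by linarith [h.s_lt_one]
    have e : B * (s ^ n - s ^ (n + (k + 1))) / (1 - s) =
        B * s ^ (n + k) + B * (s ^ n - s ^ (n + k)) / (1 - s) := by
      field_simp
      ring
    have h1 := rho_pow_add_two (n + k)
    have h2 := rho_pow_pos (n + k + 2)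
    rw [e]
    simp only [← add_assoc] at hp ⊢
    rcases mem_leftEnds_succ.1 hp with h' | ⟨y, h', rfl⟩
    · obtain ⟨a, ha, hap, hpa, hv⟩ := ih h'
      refine ⟨a, ha, hap, by linarith, ?_⟩
      have := h.left (n + k) p h'
      rw [abs_sub_comm] at this
      exact (abs_sub_le _ (v (n + k) p) _).trans (add_le_add this hv)
    · obtain ⟨a, ha, hap, hpa, hv⟩ := ih h'
      refine ⟨a, ha, by linarith, by linarith, ?_⟩
      have := h.right (n + k) y h'
      rw [abs_sub_comm] at this
      exact (abs_sub_le _ (v (n + k) y) _).trans (add_le_add this hv)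

theorem exists_ancestor_le (h : ChildBound v B s) {n m : ℕ} (hnm : n ≤ m) {p : ℝ}
    (hp : p ∈ leftEnds m) :
    ∃ a ∈ leftEnds n, a ≤ p ∧ p ≤ a + rho ^ n ∧ |v m p - v n a| ≤ B * s ^ n / (1 - s) := by
  obtain ⟨k, rfl⟩ := Nat.exists_eq_add_of_le hnm
  obtain ⟨a, ha, h1, h2, h3⟩ := h.exists_ancestor n k hp
  have h4 := rho_pow_pos (n + k)
  refine ⟨a, ha, h1, by linarith, h3.trans ?_⟩
  have := pow_nonneg h.s_nonneg (n + k)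
  exact div_le_div_of_nonneg_right (mul_le_mul_of_nonneg_left (by linarith) h.B_nonneg)
    (by linarith [h.s_lt_one])

theorem abs_sub_zero_le (h : ChildBound v B s) {m : ℕ} {p : ℝ} (hp : p ∈ leftEnds m) :
    |v m p - v 0 0| ≤ B / (1 - s) := by
  obtain ⟨a, ha, -, -, h3⟩ := h.exists_ancestor_le (Nat.zero_le m) hp
  simp only [leftEnds, Finset.mem_singleton] at ha
  simpa [ha] using h3

theorem abs_inc_le (h : ChildBound v B s) {n : ℕ} {x : ℝ} (hx : x ∈ leftEnds n)
    (hl : x ≠ 1 - rho ^ n) : |v n (x + gap n x) - v n x| ≤ 4 * B * s ^ n := by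
  have hg := add_gap_mem hx hl
  have hB : B * s ^ (n + 1) ≤ B * s ^ n :=
    mul_le_mul_of_nonneg_left (pow_le_pow_of_le_one h.s_nonneg h.s_lt_one.le (Nat.le_succ n))
      h.B_nonneg
  have hB' : 0 ≤ B * s ^ n := mul_nonneg h.B_nonneg (pow_nonneg h.s_nonneg n)
  have h1 := h.right n x hx
  have h2 := h.left n _ hg
  by_cases hs : x + rho ^ (n + 2) ∈ leftEnds n
  · rw [gap, if_pos hs] at h2 ⊢
    rw [abs_le] at *
    constructor <;> linarith [h1.1, h1.2, h2.1, h2.2]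
  · rw [gap, if_neg hs] at hg h2 ⊢
    have h3 := h.right (n + 1) _ (add_mem_leftEnds_succ hx)
    have h4 := h.left (n + 1) _ (leftEnds_subset_succ hg)
    rw [show x + rho ^ (n + 2) + rho ^ (n + 1 + 2) = x + rho ^ (n + 1) by
      rw [rho_pow_add_two (n + 1)]; ring] at h3
    rw [abs_le] at *
    constructor <;> linarith [h1.1, h1.2, h2.1, h2.2, h3.1, h3.2, h4.1, h4.2]

/-- Gaps are at least `ρ^(n+2)`, so at most `(y - x) / ρ^(n+2)` neighbour steps lead from `x` to
`y`. -/
theorem abs_sub_le_of_le (h : ChildBound v B s) {n : ℕ} {x y : ℝ} (hx : x ∈ leftEnds n)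
    (hy : y ∈ leftEnds n) (hxy : x ≤ y) :
    |v n y - v n x| ≤ 4 * B * s ^ n * ((y - x) / rho ^ (n + 2)) := by
  refine leftEnds_induction hx (motive := fun y =>
    |v n y - v n x| ≤ 4 * B * s ^ n * ((y - x) / rho ^ (n + 2))) (by simp) ?_ y hy hxy
  intro z hz _ hl ih
  have h0 : 0 ≤ 4 * B * s ^ n :=
    mul_nonneg (mul_nonneg (by norm_num) h.B_nonneg) (pow_nonneg h.s_nonneg n)
  have h1 : 1 ≤ gap n z / rho ^ (n + 2) := (one_le_div (rho_pow_pos _)).2 (le_gap n z)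
  have e : 4 * B * s ^ n * ((z + gap n z - x) / rho ^ (n + 2)) =
      4 * B * s ^ n * (gap n z / rho ^ (n + 2)) + 4 * B * s ^ n * ((z - x) / rho ^ (n + 2)) := by
    ring
  rw [e]
  refine (abs_sub_le _ (v n z) _).trans (add_le_add ((h.abs_inc_le hz hl).trans ?_) ih)
  exact le_mul_of_one_le_right h0 h1

/-- Both points climb to level `n`. An ancestor lies at most `ρ^n` to the left of its point, so the
two ancestors are within `2 ρ^n`, that is, within `2 / ρ²` neighbour steps. -/
theorem abs_sub_le_of_near (h : ChildBound v B s) {n m m' : ℕ} (hm : n ≤ m) (hm' : n ≤ m')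
    {p p' : ℝ} (hp : p ∈ leftEnds m) (hp' : p' ∈ leftEnds m') (hpp : |p - p'| ≤ rho ^ n) :
    |v m p - v m' p'| ≤ B * (2 / (1 - s) + 8 / rho ^ 2) * s ^ n := by
  obtain ⟨a, ha, h1, h2, h3⟩ := h.exists_ancestor_le hm hp
  obtain ⟨a', ha', h1', h2', h3'⟩ := h.exists_ancestor_le hm' hp'
  have h0 : 0 ≤ 4 * B * s ^ n :=
    mul_nonneg (mul_nonneg (by norm_num) h.B_nonneg) (pow_nonneg h.s_nonneg n)
  have key : ∀ a ∈ leftEnds n, ∀ a' ∈ leftEnds n, a ≤ a' → a' - a ≤ 2 * rho ^ n →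
      |v n a' - v n a| ≤ 4 * B * s ^ n * (2 / rho ^ 2) := by
    intro a ha a' ha' haa hd
    refine (h.abs_sub_le_of_le ha ha' haa).trans (mul_le_mul_of_nonneg_left ?_ h0)
    rw [div_le_div_iff₀ (rho_pow_pos _) (rho_pow_pos _), pow_add, ← mul_assoc]
    exact mul_le_mul_of_nonneg_right hd (rho_pow_pos 2).le
  have h4 : |v n a - v n a'| ≤ 4 * B * s ^ n * (2 / rho ^ 2) := by
    rw [abs_le] at hpp
    rcases le_total a a' with hl | hl
    · rw [abs_sub_comm]
      exact key a ha a' ha' hl (by linarith)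
    · exact key a' ha' a ha hl (by linarith)
  have e : B * (2 / (1 - s) + 8 / rho ^ 2) * s ^ n = B * s ^ n / (1 - s)
      + (4 * B * s ^ n * (2 / rho ^ 2) + B * s ^ n / (1 - s)) := by ring
  rw [e]
  rw [abs_sub_comm] at h3'
  exact (abs_sub_le _ (v n a) _).trans (add_le_add h3
    ((abs_sub_le _ (v n a') _).trans (add_le_add h4 h3')))

end ChildBound

end

/-! ### Coordinates on `V₁`: level and left end -/

section

/-- The top vertex of the triangle of level `n` whose base has left end `p`. -/
def pt (n : ℕ) (p : ℝ) : Plane := rho ^ n • q 0 + p • q 2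

/-- The map `F_v ∘ F_0`, where `F_v` has level `n` and left end `p`. -/
def cellMap (n : ℕ) (p : ℝ) (x : Plane) : Plane := rho ^ n • F 0 x + p • q 2

theorem q_one : q 1 = 0 := by
  ext i; fin_cases i <;> simp [q]

theorem F_zero (x : Plane) : F 0 x = rho ^ 2 • (x - q 0) + q 0 := by simp [F, ratio]

theorem F_one (x : Plane) : F 1 x = rho • x := by simp [F, ratio, q_one]

theorem F_two (x : Plane) : F 2 x = rho • x + rho ^ 2 • q 2 := by
  simp only [F, ratio, Matrix.cons_val, rho_sq]; module

theorem cellMap_q_zero (n : ℕ) (p : ℝ) : cellMap n p (q 0) = pt n p := by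
  rw [cellMap, F_zero_q_zero, pt]

theorem cellMap_q_one (n : ℕ) (p : ℝ) : cellMap n p (q 1) = pt (n + 1) p := by
  rw [cellMap, F_zero, rho_sq, q_one, pt, pow_succ]; module

theorem cellMap_q_two (n : ℕ) (p : ℝ) : cellMap n p (q 2) = pt (n + 1) (p + rho ^ (n + 2)) := by
  have h : rho ^ (n + 2) = rho ^ n * rho ^ 2 := pow_add _ _ _
  rw [cellMap, F_zero, pt, h, pow_succ rho n, rho_sq]; module

theorem Fw_append (v w : List (Fin 3)) (x : Plane) : Fw (v ++ w) x = Fw v (Fw w x) := by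
  induction v with
  | nil => rfl
  | cons i v ih => simp [Fw, ih]

theorem exists_leftEnd (v : List (Fin 3)) (hv : ∀ i ∈ v, i = 1 ∨ i = 2) :
    ∃ p ∈ leftEnds v.length, ∀ x, Fw v x = rho ^ v.length • x + p • q 2 := by
  induction v using List.reverseRecOn with
  | nil => exact ⟨0, by simp [leftEnds], fun x => by simp [Fw]⟩
  | append_singleton v i ih =>
    obtain ⟨p, hp, h⟩ := ih fun j hj => hv j (by simp [hj])
    rw [List.length_append, List.length_singleton]
    rcases hv i (by simp) with rfl | rfl
    · refine ⟨p, leftEnds_subset_succ hp, fun x => ?_⟩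
      rw [Fw_append, h, Fw, Fw, Function.comp_apply, id, F_one, pow_succ]
      module
    · refine ⟨_, add_mem_leftEnds_succ hp, fun x => ?_⟩
      rw [Fw_append, h, Fw, Fw, Function.comp_apply, id, F_two, pow_succ, pow_add]
      module

theorem exists_word_of_leftEnd {n : ℕ} {p : ℝ} (hp : p ∈ leftEnds n) :
    ∃ v : List (Fin 3), (∀ i ∈ v, i = 1 ∨ i = 2) ∧ v.length = n ∧
      ∀ x, Fw v x = rho ^ n • x + p • q 2 := by
  induction n generalizing p with
  | zero =>
    simp only [leftEnds, Finset.mem_singleton] at hp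
    exact ⟨[], by simp, rfl, fun x => by simp [Fw, hp]⟩
  | succ n ih =>
    rcases mem_leftEnds_succ.1 hp with h | ⟨y, h, rfl⟩
    · obtain ⟨v, hv, rfl, hx⟩ := ih h
      refine ⟨v ++ [1], ?_, by simp, fun x => ?_⟩
      · intro i hi
        rcases List.mem_append.1 hi with hi | hi
        · exact hv i hi
        · simp at hi; simp [hi]
      · rw [Fw_append, hx, Fw, Fw, Function.comp_apply, id, F_one, pow_succ]
        module
    · obtain ⟨v, hv, rfl, hx⟩ := ih h
      refine ⟨v ++ [2], ?_, by simp, fun x => ?_⟩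
      · intro i hi
        rcases List.mem_append.1 hi with hi | hi
        · exact hv i hi
        · simp at hi; simp [hi]
      · rw [Fw_append, hx, Fw, Fw, Function.comp_apply, id, F_two, pow_succ, pow_add]
        module

/-- The height, normalized by `height q₀ = 1`. -/
def height (z : Plane) : ℝ := 2 * z 1 / √3

/-- The first coordinate in the basis `q₂, q₀`. -/
def leftPos (z : Plane) : ℝ := z 0 - z 1 / √3

theorem height_pt (n : ℕ) (p : ℝ) : height (pt n p) = rho ^ n := by
  have h : √3 ≠ 0 := by positivity
  simp [height, pt, q]
  field_simp

theorem leftPos_pt (n : ℕ) (p : ℝ) : leftPos (pt n p) = p := by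
  have h : √3 ≠ 0 := by positivity
  simp [leftPos, pt, q]
  field_simp
  ring

/-- The height determines the level, so level and left end are well defined on `V₁` although many
words give the same map. -/
theorem pt_injective {n m : ℕ} {p p' : ℝ} (h : pt n p = pt m p') : n = m ∧ p = p' := by
  have h1 := congrArg height h
  have h2 := congrArg leftPos h
  rw [height_pt, height_pt] at h1
  rw [leftPos_pt, leftPos_pt] at h2
  exact ⟨pow_right_injective₀ rho_pos rho_lt_one.ne h1, h2⟩

theorem abs_coord_sub_le (z z' : Plane) (i : Fin 2) : |z i - z' i| ≤ dist z z' := by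
  rw [dist_eq_norm]
  simpa using PiLp.norm_apply_le (z - z') i

theorem abs_div_sqrt_three_le (a : ℝ) : |a / √3| ≤ |a| := by
  rw [abs_div]
  refine div_le_self (abs_nonneg a) ?_
  rw [abs_of_nonneg (Real.sqrt_nonneg 3), Real.one_le_sqrt]
  norm_num

theorem abs_height_sub_le (z z' : Plane) : |height z - height z'| ≤ 2 * dist z z' := by
  have e : height z - height z' = 2 * ((z 1 - z' 1) / √3) := by unfold height; ring
  rw [e, abs_mul, abs_two]
  exact mul_le_mul_of_nonneg_left
    ((abs_div_sqrt_three_le _).trans (abs_coord_sub_le z z' 1)) zero_le_two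

theorem abs_leftPos_sub_le (z z' : Plane) : |leftPos z - leftPos z'| ≤ 2 * dist z z' := by
  have e : leftPos z - leftPos z' = (z 0 - z' 0) - (z 1 - z' 1) / √3 := by unfold leftPos; ring
  rw [e, two_mul]
  exact (abs_sub _ _).trans (add_le_add (abs_coord_sub_le z z' 0)
    ((abs_div_sqrt_three_le _).trans (abs_coord_sub_le z z' 1)))

theorem dist_pt_pt_succ (n : ℕ) (p : ℝ) :
    dist (pt n p) (pt (n + 1) p) ≤ (‖q 0‖ + ‖q 2‖) * rho ^ n ∧
    dist (pt n p) (pt (n + 1) (p + rho ^ (n + 2))) ≤ (‖q 0‖ + ‖q 2‖) * rho ^ n ∧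
    dist (pt (n + 1) p) (pt (n + 1) (p + rho ^ (n + 2))) ≤ (‖q 0‖ + ‖q 2‖) * rho ^ n := by
  have h1 := rho_pow_add_two n
  have h2 := rho_pow_pos (n + 1)
  have h3 := rho_pow_pos (n + 2)
  have h0 := norm_nonneg (q 0)
  have h0' := norm_nonneg (q 2)
  have hle : rho ^ (n + 2) ≤ rho ^ n := by linarith
  have e1 : pt n p - pt (n + 1) p = rho ^ (n + 2) • q 0 := by
    rw [pt, pt, h1]; module
  have e3 : pt (n + 1) p - pt (n + 1) (p + rho ^ (n + 2)) = -(rho ^ (n + 2) • q 2) := by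
    rw [pt, pt]; module
  have e2 : pt n p - pt (n + 1) (p + rho ^ (n + 2)) = rho ^ (n + 2) • q 0 - rho ^ (n + 2) • q 2 := by
    rw [pt, pt, h1]; module
  have n0 : ‖rho ^ (n + 2) • q 0‖ ≤ ‖q 0‖ * rho ^ n := by
    rw [norm_smul, Real.norm_of_nonneg h3.le, mul_comm]
    exact mul_le_mul_of_nonneg_left hle h0
  have n2 : ‖rho ^ (n + 2) • q 2‖ ≤ ‖q 2‖ * rho ^ n := by
    rw [norm_smul, Real.norm_of_nonneg h3.le, mul_comm]
    exact mul_le_mul_of_nonneg_left hle h0'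
  have hn := rho_pow_pos n
  simp only [dist_eq_norm, e1, e2, e3, norm_neg, add_mul]
  refine ⟨n0.trans (le_add_of_nonneg_right (by positivity)),
    (norm_sub_le _ _).trans (add_le_add n0 n2), n2.trans (le_add_of_nonneg_left (by positivity))⟩

/-- The words of `W₁` correspond to the pairs (level, left end). -/
theorem exists_cellEquiv (W : CellWords) : ∃ e : (Σ n : ℕ, leftEnds n) ≃ W.words,
    ∀ c, Fw (e c) = cellMap c.1 c.2 ∧ (e c : List (Fin 3)).length = c.1 + 1 := by
  have h1 : ∀ w ∈ baseWords, ∃ n, ∃ p ∈ leftEnds n, Fw w = cellMap n p ∧ w.length = n + 1 := by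
    rintro w ⟨v, hv, rfl⟩
    obtain ⟨p, hp, h⟩ := exists_leftEnd v hv
    refine ⟨v.length, p, hp, ?_, by simp⟩
    ext1 x
    rw [Fw_append, h, cellMap, Fw, Fw, Function.comp_apply, id]
  -- The image of `q₀`, which `F₀` fixes, already determines the cell.
  have hinj : ∀ {n m : ℕ} {p p' : ℝ}, cellMap n p = cellMap m p' → n = m ∧ p = p' := by
    intro n m p p' h
    refine pt_injective ?_
    rw [← cellMap_q_zero, h, cellMap_q_zero]
  have h2 : ∀ c : (Σ n : ℕ, leftEnds n), ∃ w : W.words, Fw w = cellMap c.1 c.2 ∧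
      (w : List (Fin 3)).length = c.1 + 1 := by
    rintro ⟨n, p, hp⟩
    obtain ⟨v, hv, hlen, h⟩ := exists_word_of_leftEnd hp
    obtain ⟨w, hw, hvw⟩ := W.exists_rep (v ++ [0]) ⟨v, hv, rfl⟩
    have hFw : Fw w = cellMap n p := by
      rw [← hvw]
      ext1 x
      rw [Fw_append, h, cellMap, Fw, Fw, Function.comp_apply, id]
    obtain ⟨m, p', hp', he, hl⟩ := h1 w (W.subset_base hw)
    refine ⟨⟨w, hw⟩, hFw, ?_⟩
    rw [hl, (hinj (he.symm.trans hFw)).1]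
  choose e he hlen using h2
  have hbij : Function.Bijective e := by
    constructor
    · rintro ⟨n, p, hp⟩ ⟨m, p', hp'⟩ h
      have := (he ⟨n, p, hp⟩).symm.trans ((congrArg (fun w : W.words => Fw w) h).trans
        (he ⟨m, p', hp'⟩))
      obtain ⟨rfl, rfl⟩ := hinj this
      rfl
    · rintro ⟨w, hw⟩
      obtain ⟨n, p, hp, h, -⟩ := h1 w (W.subset_base hw)
      refine ⟨⟨n, p, hp⟩, ?_⟩
      by_contra hne
      exact W.distinct _ (e ⟨n, p, hp⟩).2 _ hw (fun h' => hne (Subtype.ext h'))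
        ((he _).trans h.symm)
  exact ⟨Equiv.ofBijective e hbij, fun c => ⟨he c, hlen c⟩⟩

/-- The bijection between pairs (level, left end) and the words of `W₁`. -/
def cellEquiv (W : CellWords) : (Σ n : ℕ, leftEnds n) ≃ W.words := (exists_cellEquiv W).choose

theorem Fw_cellEquiv (W : CellWords) (c : Σ n : ℕ, leftEnds n) :
    Fw (cellEquiv W c) = cellMap c.1 c.2 := ((exists_cellEquiv W).choose_spec c).1

theorem length_cellEquiv (W : CellWords) (c : Σ n : ℕ, leftEnds n) :
    (cellEquiv W c : List (Fin 3)).length = c.1 + 1 := ((exists_cellEquiv W).choose_spec c).2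

theorem pt_mem_V1 (W : CellWords) {n : ℕ} {p : ℝ} (hp : p ∈ leftEnds n) : pt n p ∈ V1 W := by
  have := Fw_q_mem_V1 W (cellEquiv W ⟨n, p, hp⟩) 0
  rwa [Fw_cellEquiv, cellMap_q_zero] at this

theorem mem_V1_iff (W : CellWords) {z : Plane} :
    z ∈ V1 W ↔ ∃ n, ∃ p ∈ leftEnds n, z = pt n p := by
  constructor
  · intro hz
    simp only [V1, mem_iUnion, mem_image, mem_range] at hz
    obtain ⟨w, hw, _, ⟨i, rfl⟩, rfl⟩ := hz
    obtain ⟨⟨n, p, hp⟩, h⟩ := (cellEquiv W).surjective ⟨w, hw⟩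
    have hF : Fw w = cellMap n p := by
      have := Fw_cellEquiv W ⟨n, p, hp⟩
      rwa [h] at this
    rw [hF]
    fin_cases i
    · exact ⟨n, p, hp, cellMap_q_zero n p⟩
    · exact ⟨n + 1, p, leftEnds_subset_succ hp, cellMap_q_one n p⟩
    · exact ⟨n + 1, _, add_mem_leftEnds_succ hp, cellMap_q_two n p⟩
  · rintro ⟨n, p, hp, rfl⟩
    exact pt_mem_V1 W hp

open Classical in
/-- The values of a function on `V₁` in terms of level and left end (`0` elsewhere). -/
def vals {W : CellWords} (f : V1 W → ℝ) (n : ℕ) (p : ℝ) : ℝ :=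
  if h : pt n p ∈ V1 W then f ⟨pt n p, h⟩ else 0

variable {W : CellWords}

theorem vals_eq (f : V1 W → ℝ) {n : ℕ} {p : ℝ} (h : pt n p ∈ V1 W) :
    vals f n p = f ⟨pt n p, h⟩ := dif_pos h

theorem cell_cellEquiv (f : V1 W → ℝ) (c : Σ n : ℕ, leftEnds n) :
    cell W f (cellEquiv W c) = ![vals f c.1 c.2, vals f (c.1 + 1) c.2,
      vals f (c.1 + 1) (c.2 + rho ^ (c.1 + 2))] := by
  obtain ⟨n, p, hp⟩ := c
  have key : ∀ (i : Fin 3) (m : ℕ) (p' : ℝ), cellMap n p (q i) = pt m p' →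
      cell W f (cellEquiv W ⟨n, p, hp⟩) i = vals f m p' := by
    intro i m p' h
    have h' : Fw (cellEquiv W ⟨n, p, hp⟩) (q i) = pt m p' := by rw [Fw_cellEquiv]; exact h
    rw [vals_eq f (h' ▸ Fw_q_mem_V1 W _ i), cell]
    congr 1
    exact Subtype.ext h'
  ext i
  fin_cases i
  · exact key 0 _ _ (cellMap_q_zero n p)
  · exact key 1 _ _ (cellMap_q_one n p)
  · exact key 2 _ _ (cellMap_q_two n p)

/-! ### Uniform continuity and extension to the closure -/

theorem abs_rho_pow_sub_ge {n m : ℕ} (h : n ≠ m) : rho ^ (n + 2) ≤ |rho ^ n - rho ^ m| := by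
  have h1 := rho_pow_add_two n
  rcases lt_or_gt_of_ne h with h | h
  · have := pow_le_pow_of_le_one rho_pos.le rho_lt_one.le (Nat.succ_le_of_lt h)
    exact le_trans (by simp only [Nat.succ_eq_add_one] at this; linarith) (le_abs_self _)
  · obtain ⟨k, rfl⟩ := Nat.exists_eq_succ_of_ne_zero (Nat.ne_zero_of_lt h)
    have h2 := pow_le_pow_of_le_one rho_pos.le rho_lt_one.le (Nat.le_of_lt_succ h)
    have h3 := rho_pow_add_two k
    have h4 := rho_pow_succ_lt (k + 2)
    have h5 := rho_pow_succ_lt (k + 1)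
    simp only [Nat.succ_eq_add_one, add_assoc, Nat.reduceAdd] at *
    exact le_trans (by rw [show k + (1 + 2) = k + 3 by ring]; linarith) (neg_le_abs _)

/-- For two close points of `V₁`, either both have level at least `n` and `abs_sub_le_of_near`
applies, or the separation of heights forces equal levels and the separation of left ends forces
equal points. -/
theorem ChildBound.uniformContinuous {f : V1 W → ℝ} {B s : ℝ} (h : ChildBound (vals f) B s) :
    UniformContinuous f := by
  rw [Metric.uniformContinuous_iff]
  intro ε hε
  set C := B * (2 / (1 - s) + 8 / rho ^ 2)
  have hlim : Tendsto (fun n : ℕ => C * s ^ n) atTop (𝓝 0) := by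
    simpa using (tendsto_pow_atTop_nhds_zero_of_lt_one h.s_nonneg h.s_lt_one).const_mul C
  obtain ⟨n, hn⟩ := (hlim.eventually (gt_mem_nhds hε)).exists
  -- Height and left position are both Lipschitz with constant `2`.
  refine ⟨rho ^ (n + 2) / 2, half_pos (rho_pow_pos _), ?_⟩
  rintro ⟨z, hz⟩ ⟨z', hz'⟩ hd
  obtain ⟨k, p, hp, rfl⟩ := (mem_V1_iff W).1 hz
  obtain ⟨m, p', hp', rfl⟩ := (mem_V1_iff W).1 hz'
  rw [Subtype.dist_eq] at hd
  have h1 := abs_height_sub_le (pt k p) (pt m p')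
  have h2 := abs_leftPos_sub_le (pt k p) (pt m p')
  rw [height_pt, height_pt] at h1
  rw [leftPos_pt, leftPos_pt] at h2
  have h3 : |rho ^ k - rho ^ m| < rho ^ (n + 2) := by dsimp only at hd; linarith
  have h4 : |p - p'| < rho ^ (n + 2) := by dsimp only at hd; linarith
  rw [Real.dist_eq, ← vals_eq f hz, ← vals_eq f hz']
  have hmono : ∀ {a b : ℕ}, a ≤ b → rho ^ b ≤ rho ^ a :=
    fun hab => pow_le_pow_of_le_one rho_pos.le rho_lt_one.le hab
  by_cases hk : n ≤ k ∧ n ≤ m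
  · exact (h.abs_sub_le_of_near hk.1 hk.2 hp hp'
      (h4.le.trans (hmono (Nat.le_add_right n 2)))).trans_lt hn
  · have hkm : k = m := by
      by_contra hne
      rcases not_and_or.1 hk with hk | hk
      · have := abs_rho_pow_sub_ge hne
        have := hmono (show k + 2 ≤ n + 2 by omega)
        linarith
      · have := abs_rho_pow_sub_ge (Ne.symm hne)
        have := hmono (show m + 2 ≤ n + 2 by omega)
        rw [abs_sub_comm] at h3
        linarith
    subst hkm
    have hpp : p = p' := by
      have hle := hmono (show k + 2 ≤ n + 2 by omega)
      rcases lt_trichotomy p p' with hl | hl | hl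
      · have := leftEnds_add_le hp hp' hl
        rw [abs_sub_comm] at h4
        have := le_abs_self (p' - p)
        linarith
      · exact hl
      · have := leftEnds_add_le hp' hp hl
        have := le_abs_self (p - p')
        linarith
    subst hpp
    simpa using hε

/-- The inclusion of `V₁` into its closure. -/
def incl (W : CellWords) (x : V1 W) : V1bar W := ⟨x, subset_closure x.2⟩

theorem denseRange_incl (W : CellWords) : DenseRange (incl W) := by
  intro x
  rw [Topology.IsInducing.subtypeVal.closure_eq_preimage_closure_image]
  have : (Subtype.val '' range (incl W) : Set Plane) = V1 W := by
    ext z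
    constructor
    · rintro ⟨_, ⟨y, rfl⟩, rfl⟩
      exact y.2
    · intro hz
      exact ⟨_, ⟨⟨z, hz⟩, rfl⟩, rfl⟩
  rw [mem_preimage, this]
  exact x.2

theorem isUniformInducing_incl (W : CellWords) : IsUniformInducing (incl W) :=
  (isUniformInducing_val _).of_comp_iff.1 (isUniformInducing_val _)

theorem exists_unique_extension {f : V1 W → ℝ} (hf : UniformContinuous f) :
    ∃! g : V1bar W → ℝ, Continuous g ∧ res W g = f := by
  have hd := (isUniformInducing_incl W).isDenseInducing (denseRange_incl W)
  refine ⟨hd.extend f,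
    ⟨(uniformContinuous_uniformly_extend (isUniformInducing_incl W) (denseRange_incl W)
      hf).continuous, ?_⟩, ?_⟩
  · ext x
    exact hd.extend_eq hf.continuous x
  · rintro g ⟨hg, hgf⟩
    exact (hd.extend_unique (fun x => congrFun hgf x) hg).symm

theorem ChildBound.abs_sub_le {g : V1bar W → ℝ} (hg : Continuous g) {B s : ℝ}
    (h : ChildBound (vals (res W g)) B s) (x y : V1bar W) : |g x - g y| ≤ 2 * B / (1 - s) := by
  refine (denseRange_incl W).induction_on₂ (p := fun x y => |g x - g y| ≤ 2 * B / (1 - s)) ?_ ?_ x y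
  · exact isClosed_le (by fun_prop) continuous_const
  · rintro ⟨z, hz⟩ ⟨z', hz'⟩
    obtain ⟨k, p, hp, rfl⟩ := (mem_V1_iff W).1 hz
    obtain ⟨m, p', hp', rfl⟩ := (mem_V1_iff W).1 hz'
    have h1 := h.abs_sub_zero_le hp
    have h2 := h.abs_sub_zero_le hp'
    rw [vals_eq _ hz] at h1
    rw [vals_eq _ hz', abs_sub_comm] at h2
    have e : 2 * B / (1 - s) = B / (1 - s) + B / (1 - s) := by ring
    rw [e]
    exact (_root_.abs_sub_le _ _ _).trans (add_le_add h1 h2)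

/-- The points `q₀, q₁, q₂` are limits of vertices along which the functions with geometric decay
converge at a uniform rate. -/
theorem exists_approx_q (W : CellWords) : ∃ z : Fin 3 → ℕ → V1 W,
    (∀ i, Tendsto (fun n => incl W (z i n)) atTop (𝓝 ⟨q i, q_mem_closure W i⟩)) ∧
    ∀ (f : V1 W → ℝ) (B s : ℝ), ChildBound (vals f) B s → ∀ i n m, n ≤ m →
      |f (z i n) - f (z i m)| ≤ B * (2 / (1 - s) + 8 / rho ^ 2) * s ^ n := by
  have h0 := tendsto_pow_atTop_nhds_zero_of_lt_one rho_pos.le rho_lt_one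
  -- The vertex `q₀` belongs to `V₁`; `q₁` and `q₂` are approached along the first and the last left
  -- end of each level.
  let z : Fin 3 → ℕ → V1 W := ![fun n => ⟨pt 0 0, pt_mem_V1 W (zero_mem_leftEnds 0)⟩,
    fun n => ⟨pt n 0, pt_mem_V1 W (zero_mem_leftEnds n)⟩,
    fun n => ⟨pt n (1 - rho ^ n), pt_mem_V1 W (last_mem_leftEnds n)⟩]
  refine ⟨z, ?_, ?_⟩
  · intro i
    rw [tendsto_subtype_rng]
    fin_cases i
    · have : Tendsto (fun _ : ℕ => pt 0 0) atTop (𝓝 (q 0)) := by simp [pt]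
      exact this
    · have : Tendsto (fun n : ℕ => pt n 0) atTop (𝓝 (q 1)) := by
        rw [q_one]
        simpa [pt] using h0.smul_const (q 0)
      exact this
    · have : Tendsto (fun n : ℕ => pt n (1 - rho ^ n)) atTop (𝓝 (q 2)) := by
        simpa [pt] using (h0.smul_const (q 0)).add ((h0.const_sub 1).smul_const (q 2))
      exact this
  · intro f B s h i n m hnm
    have hn := rho_pow_pos n
    have hm := rho_pow_pos m
    fin_cases i
    · have hs : 0 < 1 - s := by linarith [h.s_lt_one]
      have := rho_pow_pos 2
      have := h.B_nonneg
      have := h.s_nonneg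
      change |f ⟨pt 0 0, _⟩ - f ⟨pt 0 0, _⟩| ≤ _
      rw [sub_self, abs_zero]
      positivity
    · have := h.abs_sub_le_of_near le_rfl hnm (zero_mem_leftEnds n) (zero_mem_leftEnds m)
        (by simpa using hn.le)
      rwa [vals_eq f (pt_mem_V1 W (zero_mem_leftEnds n)),
        vals_eq f (pt_mem_V1 W (zero_mem_leftEnds m))] at this
    · have hmn := pow_le_pow_of_le_one rho_pos.le rho_lt_one.le hnm
      have := h.abs_sub_le_of_near le_rfl hnm (last_mem_leftEnds n) (last_mem_leftEnds m)
        (by rw [abs_le]; constructor <;> linarith)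
      rwa [vals_eq f (pt_mem_V1 W (last_mem_leftEnds n)),
        vals_eq f (pt_mem_V1 W (last_mem_leftEnds m))] at this

end

/-! ### Traces of resistance forms on finite sets -/

section

namespace IsResistanceForm

variable {X : Type*} {G : Set (X → ℝ)} {E : (X → ℝ) → (X → ℝ) → ℝ}

theorem sub_mem (h : IsResistanceForm G E) {f g : X → ℝ} (hf : f ∈ G) (hg : g ∈ G) : f - g ∈ G := by
  have := h.add_mem f hf _ (h.smul_mem (-1) g hg)
  rwa [neg_one_smul, ← sub_eq_add_neg] at this

theorem sub_left (h : IsResistanceForm G E) {f g k : X → ℝ} (hf : f ∈ G) (hg : g ∈ G) (hk : k ∈ G) :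
    E (f - g) k = E f k - E g k := by
  have := h.add_left _ (h.sub_mem hf hg) g hg k hk
  rw [sub_add_cancel] at this
  linarith

theorem sub_right (h : IsResistanceForm G E) {f g k : X → ℝ} (hf : f ∈ G) (hg : g ∈ G)
    (hk : k ∈ G) : E k (f - g) = E k f - E k g := by
  rw [h.symm _ hk _ (h.sub_mem hf hg), h.sub_left hf hg hk, h.symm _ hf _ hk, h.symm _ hg _ hk]

theorem add_smul_self (h : IsResistanceForm G E) {f g : X → ℝ} (hf : f ∈ G) (hg : g ∈ G) (t : ℝ) :
    E (f + t • g) (f + t • g) = E g g * (t * t) + 2 * E f g * t + E f f := by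
  have ht := h.smul_mem t g hg
  rw [h.add_left f hf _ ht _ (h.add_mem f hf _ ht), h.symm f hf _ (h.add_mem f hf _ ht),
    h.smul_left t g hg _ (h.add_mem f hf _ ht), h.add_left f hf _ ht f hf,
    h.symm g hg _ (h.add_mem f hf _ ht), h.add_left f hf _ ht g hg, h.smul_left t g hg f hf,
    h.smul_left t g hg g hg, h.symm g hg f hf]
  ring

theorem add_self (h : IsResistanceForm G E) {f g : X → ℝ} (hf : f ∈ G) (hg : g ∈ G) :
    E (f + g) (f + g) = E f f + 2 * E f g + E g g := by
  have := h.add_smul_self hf hg 1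
  rw [one_smul] at this
  rw [this]
  ring

theorem sub_self_eq (h : IsResistanceForm G E) {f g : X → ℝ} (hf : f ∈ G) (hg : g ∈ G) :
    E (f - g) (f - g) = E f f - 2 * E f g + E g g := by
  have := h.add_smul_self hf hg (-1)
  rw [neg_one_smul, ← sub_eq_add_neg] at this
  rw [this]
  ring

theorem sq_le (h : IsResistanceForm G E) {f g : X → ℝ} (hf : f ∈ G) (hg : g ∈ G) :
    E f g ^ 2 ≤ E f f * E g g := by
  have := discrim_le_zero (a := E g g) (b := 2 * E f g) (c := E f f) fun t => by
    rw [← h.add_smul_self hf hg t]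
    exact h.nonneg _ (h.add_mem f hf _ (h.smul_mem t g hg))
  unfold discrim at this
  linarith

theorem const_left (h : IsResistanceForm G E) (c : ℝ) {g : X → ℝ} (hg : g ∈ G) :
    E (fun _ => c) g = 0 := by
  have h1 := h.sq_le (h.const_mem c) hg
  rw [(h.eq_zero_iff _ (h.const_mem c)).2 ⟨c, fun _ => rfl⟩, zero_mul] at h1
  exact pow_eq_zero_iff two_ne_zero |>.1 (le_antisymm h1 (sq_nonneg _))

theorem exists_resistance_bound (h : IsResistanceForm G E) (x y : X) :
    ∃ C, 0 ≤ C ∧ ∀ f ∈ G, |f x - f y| ^ 2 ≤ C * E f f := by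
  by_cases hxy : x = y
  · exact ⟨0, le_rfl, fun f _ => by simp [hxy]⟩
  · obtain ⟨C, hC⟩ := h.resistance_finite x y hxy
    refine ⟨max C 0, le_max_right _ _, fun f hf => ?_⟩
    rcases (h.nonneg f hf).eq_or_lt with h0 | h0
    · obtain ⟨c, hc⟩ := (h.eq_zero_iff f hf).1 h0.symm
      simp [hc, ← h0]
    · exact (div_le_iff₀ h0).1 ((hC ⟨f, hf, h0, rfl⟩).trans (le_max_left _ _))

variable {Y : Type*} [Finite Y] {p : Y → X}

theorem exists_of_values (h : IsResistanceForm G E) (hp : Function.Injective p) (u : Y → ℝ) :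
    ∃ f ∈ G, ∀ i, f (p i) = u i := by
  classical
  have := Fintype.ofFinite Y
  obtain ⟨f, hf, hfu⟩ := h.exists_extension (Finset.univ.image p) (Function.extend p u 0)
  refine ⟨f, hf, fun i => ?_⟩
  rw [hfu _ (Finset.mem_image_of_mem p (Finset.mem_univ i)), hp.extend_apply]

variable [Nonempty Y]

/-- A minimizing sequence is Cauchy by the parallelogram law. Completeness holds only modulo
constants, but resistance bounds show that the limit misses `u` by one common constant, which is
then added. Orthogonality follows from near-minimality of the sequence. -/
theorem exists_harmonic (h : IsResistanceForm G E) (hp : Function.Injective p) (u : Y → ℝ) :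
    ∃ g ∈ G, (∀ i, g (p i) = u i) ∧ ∀ k ∈ G, (∀ i, k (p i) = 0) → E g k = 0 := by
  obtain ⟨f₀, hf₀, hf₀u⟩ := h.exists_of_values hp u
  set S := {t : ℝ | ∃ f ∈ G, (∀ i, f (p i) = u i) ∧ t = E f f}
  have hbdd : BddBelow S := ⟨0, by rintro _ ⟨f, hf, -, rfl⟩; exact h.nonneg f hf⟩
  have hm : ∀ f ∈ G, (∀ i, f (p i) = u i) → sInf S ≤ E f f :=
    fun f hf hfu => csInf_le hbdd ⟨f, hf, hfu, rfl⟩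
  have hseq : ∀ n : ℕ, ∃ f ∈ G, (∀ i, f (p i) = u i) ∧ E f f < sInf S + 1 / ((n : ℝ) + 1) := by
    intro n
    obtain ⟨_, ⟨f, hf, hfu, rfl⟩, hlt⟩ := exists_lt_of_csInf_lt (s := S) ⟨_, f₀, hf₀, hf₀u, rfl⟩
      (lt_add_of_pos_right (sInf S) (Nat.one_div_pos_of_nat (α := ℝ) (n := n)))
    exact ⟨f, hf, hfu, hlt⟩
  choose f hf hfu hfE using hseq
  have hsmall : ∀ ε > 0, ∃ N : ℕ, ∀ n ≥ N, 1 / ((n : ℝ) + 1) < ε := by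
    intro ε hε
    exact eventually_atTop.1
      ((tendsto_one_div_add_atTop_nhds_zero_nat (𝕜 := ℝ)).eventually (gt_mem_nhds hε))
  obtain ⟨g, hg, hlim⟩ := h.complete f hf (by
    intro ε hε
    obtain ⟨N, hN⟩ := hsmall (ε / 4) (by linarith)
    refine ⟨N, fun m hmN n hnN => ?_⟩
    have hadd := h.add_mem _ (hf m) _ (hf n)
    -- The midpoint has the same boundary values, so it competes in the infimum.
    have h1 := hm ((1 / 2 : ℝ) • (f m + f n)) (h.smul_mem _ _ hadd) fun i => by
      simp [hfu]; ring
    rw [h.smul_left _ _ hadd _ (h.smul_mem _ _ hadd), h.symm _ hadd _ (h.smul_mem _ _ hadd),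
      h.smul_left _ _ hadd _ hadd, h.add_self (hf m) (hf n)] at h1
    rw [h.sub_self_eq (hf m) (hf n)]
    linarith [hfE m, hfE n, hN m hmN, hN n hnN])
  obtain ⟨i₀⟩ := ‹Nonempty Y›
  have hval : ∀ i, u i - g (p i) = u i₀ - g (p i₀) := by
    intro i
    obtain ⟨C, hC, hb⟩ := h.exists_resistance_bound (p i) (p i₀)
    have h1 : ∀ n, |(u i - g (p i)) - (u i₀ - g (p i₀))| ^ 2 ≤ C * E (f n - g) (f n - g) := by
      intro n
      have := hb (f n - g) (h.sub_mem (hf n) hg)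
      simpa [hfu] using this
    have h2 := ge_of_tendsto' (hlim.const_mul C) h1
    rw [mul_zero] at h2
    have h3 := pow_eq_zero_iff two_ne_zero |>.1 (le_antisymm h2 (sq_nonneg _))
    linarith [abs_eq_zero.1 h3]
  set c := u i₀ - g (p i₀)
  have hc := h.const_mem c
  refine ⟨g + fun _ => c, h.add_mem g hg _ hc, fun i => ?_, fun k hk hk0 => ?_⟩
  · have := hval i
    simp only [Pi.add_apply]
    linarith
  · rw [h.add_left g hg _ hc k hk, h.const_left c hk, add_zero]
    have h1 : ∀ n, E (f n) k ^ 2 ≤ 1 / ((n : ℝ) + 1) * E k k := by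
      intro n
      -- Moving `f n` by `t • k` cannot lower its energy by more than `1 / (n + 1)`; the
      -- discriminant of this quadratic in `t` bounds `E (f n) k`.
      have := discrim_le_zero (a := E k k) (b := 2 * E (f n) k) (c := 1 / ((n : ℝ) + 1)) fun t => by
        have h2 := hm (f n + t • k) (h.add_mem _ (hf n) _ (h.smul_mem t k hk))
          fun i => by simp [hfu, hk0]
        rw [h.add_smul_self (hf n) hk t] at h2
        linarith [hfE n]
      unfold discrim at this
      linarith
    have h2 : ∀ n : ℕ, E g k ^ 2 ≤ 2 * E k k * (1 / ((n : ℝ) + 1) + E (f n - g) (f n - g)) := by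
      intro n
      have h3 := h.sq_le (h.sub_mem (hf n) hg) hk
      have h4 := h1 n
      have h5 : E g k = E (f n) k - E (f n - g) k := by rw [h.sub_left (hf n) hg hk]; ring
      rw [h5]
      linarith [sq_nonneg (E (f n) k + E (f n - g) k)]
    have h3 := ge_of_tendsto' (((tendsto_one_div_add_atTop_nhds_zero_nat (𝕜 := ℝ)).add
      hlim).const_mul (2 * E k k)) h2
    rw [add_zero, mul_zero] at h3
    exact pow_eq_zero_iff two_ne_zero |>.1 (le_antisymm h3 (sq_nonneg _))

/-- The trace of a resistance form on a finite set is a resistance form. -/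
theorem exists_trace (h : IsResistanceForm G E) (hp : Function.Injective p) :
    ∃ E' : (Y → ℝ) → (Y → ℝ) → ℝ, IsResistanceForm univ E' ∧
      ∀ u, E' u u = sInf {t : ℝ | ∃ f ∈ G, (∀ i, f (p i) = u i) ∧ t = E f f} := by
  -- The choice `H` need not be linear; by orthogonality, pairing any extension of `u` with `H v`
  -- gives the same value, and this yields bilinearity.
  choose H hH hval horth using h.exists_harmonic hp
  have orth_eq : ∀ (f : X → ℝ) (hf : f ∈ G) (u v : Y → ℝ), (∀ i, f (p i) = u i) →
      E f (H v) = E (H u) (H v) := by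
    intro f hf u v hfu
    have := horth v (f - H u) (h.sub_mem hf (hH u)) fun i => by simp [hfu, hval]
    rw [h.symm _ (hH v) _ (h.sub_mem hf (hH u)), h.sub_left hf (hH u) (hH v)] at this
    linarith
  have hmin : ∀ (f : X → ℝ) (hf : f ∈ G) (u : Y → ℝ), (∀ i, f (p i) = u i) →
      E (H u) (H u) ≤ E f f := by
    intro f hf u hfu
    have h1 := h.nonneg _ (h.sub_mem hf (hH u))
    rw [h.sub_self_eq hf (hH u), orth_eq f hf u u hfu] at h1
    linarith
  refine ⟨fun u v => E (H u) (H v), ?_, fun u => ?_⟩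
  · refine ⟨fun _ => trivial, fun _ _ _ _ => trivial, fun _ _ _ => trivial,
      fun u _ v _ => h.symm _ (hH u) _ (hH v), ?_, ?_, fun u _ => h.nonneg _ (hH u), ?_, ?_,
      fun _ u => ⟨u, trivial, fun _ _ => rfl⟩, ?_, fun u _ => ⟨trivial, ?_⟩⟩
    · intro u _ v _ w _
      rw [← h.add_left _ (hH u) _ (hH v) _ (hH w),
        orth_eq _ (h.add_mem _ (hH u) _ (hH v)) (u + v) w fun i => by simp [hval]]
    · intro c u _ w _
      rw [← h.smul_left c _ (hH u) _ (hH w),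
        orth_eq _ (h.smul_mem c _ (hH u)) (c • u) w fun i => by simp [hval]]
    · intro u _
      rw [h.eq_zero_iff _ (hH u)]
      constructor
      · rintro ⟨c, hc⟩
        exact ⟨c, fun i => by rw [← hval u i, hc]⟩
      · rintro ⟨c, hc⟩
        refine (h.eq_zero_iff _ (hH u)).1 (le_antisymm ?_ (h.nonneg _ (hH u)))
        refine (hmin _ (h.const_mem c) u fun i => (hc i).symm).trans (le_of_eq ?_)
        exact (h.eq_zero_iff _ (h.const_mem c)).2 ⟨c, fun _ => rfl⟩
    · intro f _ hf
      have hsub : ∀ u v : Y → ℝ, E (H (u - v)) (H (u - v)) = E (H u - H v) (H u - H v) := by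
        intro u v
        have hs := h.sub_mem (hH u) (hH v)
        have hsv : ∀ i, (H u - H v) (p i) = (u - v) i := fun i => by simp [hval]
        rw [← orth_eq _ hs _ (u - v) hsv, h.symm _ hs _ (hH _), h.sub_right (hH u) (hH v) (hH _),
          h.symm _ (hH _) _ (hH u), h.symm _ (hH _) _ (hH v), h.sub_right (hH u) (hH v) hs,
          h.symm _ (hH u) _ (hH _), h.symm _ (hH v) _ (hH _), ← orth_eq _ hs _ u hsv,
          ← orth_eq _ hs _ v hsv]
      obtain ⟨g, hg, hlim⟩ := h.complete (fun n => H (f n)) (fun n => hH _) (by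
        simpa only [hsub] using hf)
      refine ⟨fun i => g (p i), trivial, squeeze_zero (fun n => h.nonneg _ (hH _)) (fun n => ?_) hlim⟩
      exact hmin _ (h.sub_mem (hH _) hg) _ fun i => by simp [hval]
    · intro i j hij
      obtain ⟨C, hC, hb⟩ := h.exists_resistance_bound (p i) (p j)
      refine ⟨C, ?_⟩
      rintro _ ⟨u, -, hu, rfl⟩
      rw [div_le_iff₀ hu]
      simpa [hval] using hb (H u) (hH u)
    · exact (hmin _ (h.markov _ (hH u)).1 _ fun i => by simp [hval]).trans (h.markov _ (hH u)).2
  · refine (IsLeast.csInf_eq (And.intro ?_ ?_)).symm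
    · exact ⟨H u, hH u, hval u, rfl⟩
    · rintro _ ⟨f, hf, hfu, rfl⟩
      exact hmin f hf u hfu

end IsResistanceForm

end

/-! ### Comparison with unit conductances and the energy series -/

section

/-- The resistance form on `V₀` with unit conductances. -/
def sqForm (u : Fin 3 → ℝ) : ℝ := (u 0 - u 1) ^ 2 + (u 0 - u 2) ^ 2 + (u 1 - u 2) ^ 2

namespace FormsV0

theorem nonneg (D : FormsV0) (u : Fin 3 → ℝ) : 0 ≤ D.form u u :=
  D.isResistanceForm.nonneg u trivial

theorem form_self_le (D : FormsV0) {a : ℝ} (ha : ∀ i, D.coeff i ≤ a) (u : Fin 3 → ℝ) :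
    D.form u u ≤ a * sqForm u := by
  rw [D.form_eq, sqForm]
  nlinarith [mul_le_mul_of_nonneg_right (ha 0) (sq_nonneg (u 0 - u 1)),
    mul_le_mul_of_nonneg_right (ha 1) (sq_nonneg (u 0 - u 2)),
    mul_le_mul_of_nonneg_right (ha 2) (sq_nonneg (u 1 - u 2))]

/-- Completing squares reduces the bound to positivity of `a + c`, `b + c` and `ab + bc + ca`. Only
definiteness of the form is used, not the sign of the conductances. -/
theorem exists_mul_sqForm_le (D : FormsV0) : ∃ c > 0, ∀ u, c * sqForm u ≤ D.form u u := by
  have hpos : ∀ u : Fin 3 → ℝ, u 0 ≠ u 1 ∨ u 0 ≠ u 2 → 0 < D.form u u := by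
    intro u hu
    refine (D.nonneg u).lt_of_ne fun h => ?_
    obtain ⟨c, hc⟩ := (D.isResistanceForm.eq_zero_iff u trivial).1 h.symm
    simp [hc] at hu
  have h1 := hpos ![0, 1, 0] (by simp)
  have h2 := hpos ![0, 0, 1] (by simp)
  simp only [D.form_eq, Matrix.cons_val] at h1 h2
  -- This vector annihilates the square in `e1` below, so its energy is `(a + c)(ab + bc + ca)`.
  have h3 := hpos ![0, D.coeff 2, D.coeff 0 + D.coeff 2]
    (by right; simp only [Matrix.cons_val]; intro h; linarith)
  have hform := D.form_eq
  generalize D.coeff 0 = a at *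
  generalize D.coeff 1 = b at *
  generalize D.coeff 2 = c at *
  rw [hform] at h3
  simp only [Matrix.cons_val] at h3
  have hdet : 0 < a * b + b * c + c * a := by
    have : 0 < (a + c) * (a * b + b * c + c * a) := by nlinarith
    exact (pos_iff_pos_of_mul_pos this).1 (by linarith)
  have hA : 0 < a + c := by linarith
  have hB : 0 < b + c := by linarith
  refine ⟨(a * b + b * c + c * a) / (3 * (a + c + (b + c))), by positivity, fun u => ?_⟩
  rw [div_mul_eq_mul_div, div_le_iff₀ (by positivity), hform, sqForm]
  obtain ⟨x, hx⟩ : ∃ x, x = u 0 - u 1 := ⟨_, rfl⟩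
  obtain ⟨y, hy⟩ : ∃ y, y = u 0 - u 2 := ⟨_, rfl⟩
  have hz : u 1 - u 2 = y - x := by rw [hx, hy]; ring
  rw [← hx, ← hy, hz]
  have e1 : (a + c) * (a * x * x + b * y * y + c * (y - x) * (y - x)) =
      ((a + c) * x - c * y) ^ 2 + (a * b + b * c + c * a) * y ^ 2 := by ring
  have e2 : (b + c) * (a * x * x + b * y * y + c * (y - x) * (y - x)) =
      ((b + c) * y - c * x) ^ 2 + (a * b + b * c + c * a) * x ^ 2 := by ring
  have e3 : (a * b + b * c + c * a) * (x ^ 2 + y ^ 2 + (y - x) ^ 2) ≤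
      (a * b + b * c + c * a) * (3 * (x ^ 2 + y ^ 2)) :=
    mul_le_mul_of_nonneg_left (by nlinarith [sq_nonneg (x + y)]) hdet.le
  nlinarith [sq_nonneg ((a + c) * x - c * y), sq_nonneg ((b + c) * y - c * x)]

theorem continuous_coeff : Continuous FormsV0.coeff := continuous_induced_dom

theorem tendsto_coeff (D : FormsV0) (i : Fin 3) :
    Tendsto (fun D' : FormsV0 => D'.coeff i) (𝓝 D) (𝓝 (D.coeff i)) :=
  ((continuous_apply i).comp continuous_coeff).tendsto D

theorem eventually_mul_sqForm_le (D : FormsV0) :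
    ∃ c > 0, ∀ᶠ D' in 𝓝 D, ∀ u, c * sqForm u ≤ D'.form u u := by
  obtain ⟨c, hc, h⟩ := D.exists_mul_sqForm_le
  refine ⟨c / 2, half_pos hc, ?_⟩
  have hev : ∀ i, ∀ᶠ D' : FormsV0 in 𝓝 D, D.coeff i - c / 2 < D'.coeff i := fun i =>
    (D.tendsto_coeff i).eventually (lt_mem_nhds (by linarith))
  filter_upwards [hev 0, hev 1, hev 2] with D' h0 h1 h2 u
  have := h u
  rw [form_eq] at this ⊢
  unfold sqForm at *
  nlinarith [mul_le_mul_of_nonneg_right h0.le (sq_nonneg (u 0 - u 1)),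
    mul_le_mul_of_nonneg_right h1.le (sq_nonneg (u 0 - u 2)),
    mul_le_mul_of_nonneg_right h2.le (sq_nonneg (u 1 - u 2))]

theorem eventually_coeff_le (D : FormsV0) : ∃ a > 0, ∀ᶠ D' : FormsV0 in 𝓝 D, ∀ i, D'.coeff i ≤ a := by
  refine ⟨|D.coeff 0| + |D.coeff 1| + |D.coeff 2| + 1, by positivity, ?_⟩
  rw [eventually_all]
  intro i
  have hlt : D.coeff i < |D.coeff 0| + |D.coeff 1| + |D.coeff 2| + 1 := by
    have h0 := abs_nonneg (D.coeff 0)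
    have h1 := abs_nonneg (D.coeff 1)
    have h2 := abs_nonneg (D.coeff 2)
    have := le_abs_self (D.coeff i)
    fin_cases i <;> simp only [Fin.zero_eta, Fin.mk_one, Fin.reduceFinMk] at * <;> linarith
  exact ((D.tendsto_coeff i).eventually (gt_mem_nhds hlt)).mono fun _ h => h.le

end FormsV0

variable {W : CellWords} {r : ℝ} {D : FormsV0}

theorem psiTerm_nonneg (hr : 0 < r) (f : V1 W → ℝ) (w : W.words) : 0 ≤ psiTerm W r D f f w :=
  mul_nonneg (zpow_pos hr _).le (D.nonneg _)

theorem psiTerm_cellEquiv (r : ℝ) (D : FormsV0) (f g : V1 W → ℝ) (c : Σ n : ℕ, leftEnds n) :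
    psiTerm W r D f g (cellEquiv W c) =
      (r ^ c.1)⁻¹ * D.form (cell W f (cellEquiv W c)) (cell W g (cellEquiv W c)) := by
  rw [psiTerm, length_cellEquiv]
  congr 1
  rw [Nat.cast_succ, neg_add, neg_add_cancel_right, zpow_neg, zpow_natCast]

theorem sqForm_cell (f : V1 W → ℝ) (c : Σ n : ℕ, leftEnds n) :
    sqForm (cell W f (cellEquiv W c)) = cellSq (vals f) c.1 c.2 := by
  rw [cell_cellEquiv]
  simp [sqForm, cellSq]

theorem psiTerm_add_left (f g h : V1 W → ℝ) (w : W.words) :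
    psiTerm W r D (f + g) h w = psiTerm W r D f h w + psiTerm W r D g h w := by
  rw [psiTerm, psiTerm, psiTerm, ← mul_add, ← D.isResistanceForm.add_left _ trivial _ trivial _ trivial]
  rfl

theorem psiTerm_smul_left (c : ℝ) (f h : V1 W → ℝ) (w : W.words) :
    psiTerm W r D (c • f) h w = c * psiTerm W r D f h w := by
  rw [psiTerm, psiTerm, mul_left_comm, ← D.isResistanceForm.smul_left c _ trivial _ trivial]
  rfl

theorem psiTerm_symm (f h : V1 W → ℝ) (w : W.words) :
    psiTerm W r D f h w = psiTerm W r D h f w := by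
  rw [psiTerm, psiTerm, D.isResistanceForm.symm _ trivial _ trivial]

theorem psiTerm_add_self (f g : V1 W → ℝ) (w : W.words) :
    psiTerm W r D (f + g) (f + g) w =
      psiTerm W r D f f w + 2 * psiTerm W r D f g w + psiTerm W r D g g w := by
  rw [psiTerm_add_left, psiTerm_symm f, psiTerm_symm g, psiTerm_add_left, psiTerm_add_left,
    psiTerm_symm g f]
  ring

theorem psiTerm_smul_self (c : ℝ) (f : V1 W → ℝ) (w : W.words) :
    psiTerm W r D (c • f) (c • f) w = c ^ 2 * psiTerm W r D f f w := by
  rw [psiTerm_smul_left, psiTerm_symm, psiTerm_smul_left]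
  ring

theorem psiTerm_add_const (f : V1 W → ℝ) (c : ℝ) (w : W.words) :
    psiTerm W r D (fun x => f x + c) (fun x => f x + c) w = psiTerm W r D f f w := by
  simp only [psiTerm, FormsV0.form_eq, cell, add_sub_add_right_eq_sub]

theorem two_mul_abs_psiTerm_le (hr : 0 < r) (f g : V1 W → ℝ) (w : W.words) :
    2 * |psiTerm W r D f g w| ≤ psiTerm W r D f f w + psiTerm W r D g g w := by
  have h1 := psiTerm_nonneg (D := D) hr (f + g) w
  have h2 := psiTerm_nonneg (D := D) hr (f + (-1 : ℝ) • g) w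
  rw [psiTerm_add_self] at h1 h2
  rw [psiTerm_smul_self, psiTerm_symm f ((-1 : ℝ) • g), psiTerm_smul_left, psiTerm_symm g f] at h2
  cases abs_cases (psiTerm W r D f g w) <;> linarith

theorem summable_psiTerm (hr : 0 < r) {f g : V1 W → ℝ} (hf : f ∈ psiDom W r D)
    (hg : g ∈ psiDom W r D) : Summable (psiTerm W r D f g) := by
  refine Summable.of_norm_bounded (Summable.add hf hg) fun w => ?_
  have := two_mul_abs_psiTerm_le (D := D) hr f g w
  have := abs_nonneg (psiTerm W r D f g w)
  rw [Real.norm_eq_abs]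
  linarith

theorem add_mem_psiDom (hr : 0 < r) {f g : V1 W → ℝ} (hf : f ∈ psiDom W r D)
    (hg : g ∈ psiDom W r D) : f + g ∈ psiDom W r D := by
  have := (Summable.add hf ((summable_psiTerm hr hf hg).mul_left 2)).add hg
  exact this.congr fun w => (psiTerm_add_self f g w).symm

theorem smul_mem_psiDom (c : ℝ) {f : V1 W → ℝ} (hf : f ∈ psiDom W r D) :
    c • f ∈ psiDom W r D :=
  (Summable.mul_left (c ^ 2) hf).congr fun w => (psiTerm_smul_self c f w).symm

theorem psi_nonneg (hr : 0 < r) (f : V1 W → ℝ) : 0 ≤ psi W r D f f :=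
  tsum_nonneg fun w => psiTerm_nonneg hr f w

theorem cellSq_le_of_psi_le (hr : 0 < r) {c K : ℝ} (hc : 0 < c)
    (hD : ∀ u, c * sqForm u ≤ D.form u u) {f : V1 W → ℝ} (hf : f ∈ psiDom W r D)
    (hK : psi W r D f f ≤ K) {n : ℕ} {p : ℝ} (hp : p ∈ leftEnds n) :
    cellSq (vals f) n p ≤ K / c * r ^ n := by
  have h1 := (hf.le_tsum (cellEquiv W ⟨n, p, hp⟩) fun w _ => psiTerm_nonneg hr f w).trans hK
  rw [psiTerm_cellEquiv] at h1
  have h2 := (mul_le_mul_of_nonneg_left (hD _) (inv_nonneg.2 (pow_pos hr n).le)).trans h1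
  rw [sqForm_cell] at h2
  rw [div_mul_eq_mul_div, le_div_iff₀ hc]
  rw [inv_mul_le_iff₀ (pow_pos hr n)] at h2
  linarith

/-- The energy of one cell is at most the total energy. The constants depend on `r` and `D` only
through `r₁` and `c`, so one bound serves all nearby parameters. -/
theorem childBound_of_psi_le (hr : 0 < r) {r₁ c K : ℝ} (hr₁ : r ≤ r₁) (hr₁' : r₁ < 1) (hc : 0 < c)
    (hD : ∀ u, c * sqForm u ≤ D.form u u) {f : V1 W → ℝ} (hf : f ∈ psiDom W r D)
    (hK : psi W r D f f ≤ K) : ChildBound (vals f) (√(K / c)) (√r₁) := by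
  have hK0 : 0 ≤ K / c := div_nonneg ((psi_nonneg hr f).trans hK) hc.le
  have key : ∀ n, ∀ p ∈ leftEnds n, ∀ d : ℝ, d ^ 2 ≤ cellSq (vals f) n p →
      |d| ≤ √(K / c) * √r₁ ^ n := by
    intro n p hp d hd
    refine abs_le_of_sq_le_sq (hd.trans ((cellSq_le_of_psi_le hr hc hD hf hK hp).trans ?_))
      (by positivity)
    rw [mul_pow, Real.sq_sqrt hK0, ← pow_mul, mul_comm n 2, pow_mul,
      Real.sq_sqrt (hr.le.trans hr₁)]
    gcongr
  refine ⟨fun n p hp => key n p hp _ ?_, fun n p hp => key n p hp _ ?_, Real.sqrt_nonneg _, ?_⟩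
  · unfold cellSq
    nlinarith [sq_nonneg (vals f n p - vals f (n + 1) (p + rho ^ (n + 2))),
      sq_nonneg (vals f (n + 1) p - vals f (n + 1) (p + rho ^ (n + 2)))]
  · unfold cellSq
    nlinarith [sq_nonneg (vals f n p - vals f (n + 1) p),
      sq_nonneg (vals f (n + 1) p - vals f (n + 1) (p + rho ^ (n + 2)))]
  · rw [Real.sqrt_lt' one_pos]
    linarith

theorem tendsto_psiTerm {ι : Type*} {l : Filter ι} {R : ι → ℝ} {D' : ι → FormsV0}
    {h : ι → V1 W → ℝ} {h₀ : V1 W → ℝ} (hr : 0 < r) (hR : Tendsto R l (𝓝 r))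
    (hD : Tendsto D' l (𝓝 D)) (hh : ∀ z, Tendsto (fun i => h i z) l (𝓝 (h₀ z))) (w : W.words) :
    Tendsto (fun i => psiTerm W (R i) (D' i) (h i) (h i) w) l (𝓝 (psiTerm W r D h₀ h₀ w)) := by
  unfold psiTerm
  refine (hR.zpow₀ _ (Or.inl hr.ne')).mul ?_
  simp only [FormsV0.form_eq]
  have hc : ∀ i, Tendsto (fun j => (D' j).coeff i) l (𝓝 (D.coeff i)) :=
    fun i => (D.tendsto_coeff i).comp hD
  have hcell : ∀ i j, Tendsto (fun k => cell W (h k) w i - cell W (h k) w j) l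
      (𝓝 (cell W h₀ w i - cell W h₀ w j)) := fun i j => (hh _).sub (hh _)
  exact ((((hc 0).mul (hcell 0 1)).mul (hcell 0 1)).add
    (((hc 1).mul (hcell 0 2)).mul (hcell 0 2))).add (((hc 2).mul (hcell 1 2)).mul (hcell 1 2))

/-- Lower semicontinuity of the energy under pointwise convergence. -/
theorem psi_le_of_tendsto {ι : Type*} {l : Filter ι} [l.NeBot] {R : ι → ℝ} {D' : ι → FormsV0}
    {h : ι → V1 W → ℝ} {h₀ : V1 W → ℝ} {K : ℝ} (hr : 0 < r) (hR : Tendsto R l (𝓝 r))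
    (hD : Tendsto D' l (𝓝 D)) (hh : ∀ z, Tendsto (fun i => h i z) l (𝓝 (h₀ z)))
    (hE : ∀ᶠ i in l, h i ∈ psiDom W (R i) (D' i) ∧ psi W (R i) (D' i) (h i) (h i) ≤ K) :
    h₀ ∈ psiDom W r D ∧ psi W r D h₀ h₀ ≤ K := by
  have hfin : ∀ s : Finset W.words, ∑ w ∈ s, psiTerm W r D h₀ h₀ w ≤ K := by
    intro s
    refine le_of_tendsto (tendsto_finsetSum s fun w _ => tendsto_psiTerm hr hR hD hh w) ?_
    filter_upwards [hE, hR.eventually (lt_mem_nhds hr)] with i hi hri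
    exact (hi.1.sum_le_tsum s fun w _ => psiTerm_nonneg hri (h i) w).trans hi.2
  exact ⟨summable_of_sum_le (psiTerm_nonneg hr h₀) hfin, Real.tsum_le_of_sum_le
    (psiTerm_nonneg hr h₀) hfin⟩

theorem pos_of_mem_Ioo_rho (hr : r ∈ Ioo rho 1) : 0 < r := rho_pos.trans hr.1

theorem uniformContinuous_of_mem_psiDom (hr : r ∈ Ioo rho 1) {f : V1 W → ℝ}
    (hf : f ∈ psiDom W r D) : UniformContinuous f := by
  obtain ⟨c, hc, hD⟩ := D.exists_mul_sqForm_le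
  exact (childBound_of_psi_le (pos_of_mem_Ioo_rho hr) le_rfl hr.2 hc hD hf le_rfl).uniformContinuous

/-- Using the energy of `f` itself as the bound `K` makes the oscillation estimate homogeneous; it
yields finite resistances, the kernel and completeness. -/
theorem exists_abs_sub_le (hr : r ∈ Ioo rho 1) (D : FormsV0) : ∃ C ≥ 0, ∀ f ∈ psiBarDom W r D,
    ∀ x y, |f x - f y| ≤ C * √(psiBar W r D f f) := by
  obtain ⟨c, hc, hD⟩ := D.exists_mul_sqForm_le
  have hs : √r < 1 := by
    rw [Real.sqrt_lt' one_pos]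
    linarith [hr.2]
  refine ⟨2 / √c / (1 - √r), div_nonneg (by positivity) (by linarith), fun f hf x y => ?_⟩
  have := (childBound_of_psi_le (pos_of_mem_Ioo_rho hr) le_rfl hr.2 hc hD hf.2 le_rfl).abs_sub_le
    hf.1 x y
  rw [Real.sqrt_div (psi_nonneg (pos_of_mem_Ioo_rho hr) _)] at this
  refine this.trans (le_of_eq ?_)
  rw [psiBar]
  ring

end

/-! ### Core functions and the resistance form on the closure -/

section

variable {W : CellWords} {r : ℝ} {D : FormsV0}

theorem tsum_leftEnds (n : ℕ) (F : ℝ → ℝ) : ∑' p : leftEnds n, F p = ∑ p ∈ leftEnds n, F p := by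
  rw [tsum_fintype]
  exact Finset.sum_coe_sort (leftEnds n) F

theorem hasSum_cells (hr : 0 < r) (v : ℕ → ℝ → ℝ)
    (hs : Summable fun n => (r ^ n)⁻¹ * levelSq v n) :
    HasSum (fun c : Σ n : ℕ, leftEnds n => (r ^ c.1)⁻¹ * cellSq v c.1 c.2)
      (∑' n, (r ^ n)⁻¹ * levelSq v n) := by
  have hlev : ∀ n : ℕ, ∑' p : leftEnds n, (r ^ n)⁻¹ * cellSq v n p = (r ^ n)⁻¹ * levelSq v n := by
    intro n
    rw [tsum_leftEnds n fun p => (r ^ n)⁻¹ * cellSq v n p, levelSq, Finset.mul_sum]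
  have hsum : Summable fun c : Σ n : ℕ, leftEnds n => (r ^ c.1)⁻¹ * cellSq v c.1 c.2 := by
    rw [summable_sigma_of_nonneg fun c =>
      mul_nonneg (inv_nonneg.2 (pow_pos hr _).le) (cellSq_nonneg _ _ _)]
    exact ⟨fun n => Summable.of_finite, hs.congr fun n => (hlev n).symm⟩
  have := hsum.hasSum
  rw [hsum.tsum_sigma] at this
  simpa only [hlev] using this

theorem psi_le_of_summable_levelSq (hr : 0 < r) {a : ℝ} (ha : ∀ i, D.coeff i ≤ a) {f : V1 W → ℝ}
    (hs : Summable fun n => (r ^ n)⁻¹ * levelSq (vals f) n) :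
    f ∈ psiDom W r D ∧ psi W r D f f ≤ a * ∑' n, (r ^ n)⁻¹ * levelSq (vals f) n := by
  have hc := hasSum_cells hr (vals f) hs
  have hle : ∀ c, psiTerm W r D f f (cellEquiv W c) ≤ a * ((r ^ c.1)⁻¹ * cellSq (vals f) c.1 c.2) := by
    intro c
    rw [psiTerm_cellEquiv, ← sqForm_cell, mul_left_comm]
    exact mul_le_mul_of_nonneg_left (D.form_self_le ha _) (inv_nonneg.2 (pow_pos hr _).le)
  have hsum : Summable (psiTerm W r D f f ∘ cellEquiv W) :=
    Summable.of_nonneg_of_le (fun c => psiTerm_nonneg hr f _) hle (hc.mul_left a).summable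
  refine ⟨(cellEquiv W).summable_iff.1 hsum, ?_⟩
  rw [psi, ← (cellEquiv W).tsum_eq, ← (hc.mul_left a).tsum_eq]
  exact hsum.tsum_le_tsum hle (hc.mul_left a).summable

theorem summable_levelSq (hr : 0 < r) {f : V1 W → ℝ} (hf : f ∈ psiDom W r D) :
    Summable fun n => (r ^ n)⁻¹ * levelSq (vals f) n := by
  obtain ⟨c, hc, hD⟩ := D.exists_mul_sqForm_le
  have hsum : Summable (psiTerm W r D f f ∘ cellEquiv W) := (cellEquiv W).summable_iff.2 hf
  have hcell : Summable fun k : Σ n : ℕ, leftEnds n => (r ^ k.1)⁻¹ * cellSq (vals f) k.1 k.2 := by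
    refine Summable.of_nonneg_of_le (fun k => mul_nonneg (inv_nonneg.2 (pow_pos hr _).le)
      (cellSq_nonneg _ _ _)) (fun k => ?_) (hsum.mul_left c⁻¹)
    rw [Function.comp_apply, psiTerm_cellEquiv, ← sqForm_cell, mul_left_comm]
    refine mul_le_mul_of_nonneg_left ?_ (inv_nonneg.2 (pow_pos hr _).le)
    rw [le_inv_mul_iff₀ hc]
    exact hD _
  refine hcell.sigma.congr fun n => ?_
  rw [tsum_leftEnds n fun p => (r ^ n)⁻¹ * cellSq (vals f) n p, levelSq, Finset.mul_sum]

/-- The functions on `V₁` that have finite energy for all parameters. -/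
def IsCore (f : V1 W → ℝ) : Prop := ∀ r ∈ Ioo rho 1, ∀ D : FormsV0, f ∈ psiDom W r D

theorem IsCore.add {f g : V1 W → ℝ} (hf : IsCore f) (hg : IsCore g) : IsCore (f + g) :=
  fun r hr D => add_mem_psiDom (pos_of_mem_Ioo_rho hr) (hf r hr D) (hg r hr D)

theorem IsCore.smul (c : ℝ) {f : V1 W → ℝ} (hf : IsCore f) : IsCore (c • f) :=
  fun r hr D => smul_mem_psiDom c (hf r hr D)

theorem isCore_of_levelSq_le {f : V1 W → ℝ} {C : ℝ} (N : ℕ)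
    (h : ∀ n ≥ N, levelSq (vals f) n ≤ C * rho ^ n) : IsCore f := by
  intro r hr D
  have hr0 := pos_of_mem_Ioo_rho hr
  obtain ⟨a, -, ha⟩ := D.eventually_coeff_le
  refine (psi_le_of_summable_levelSq hr0 ha.self_of_nhds ((summable_nat_add_iff N).1 ?_)).1
  have hgeo : Summable fun n : ℕ => C * (rho / r) ^ n :=
    (summable_geometric_of_lt_one (div_nonneg rho_pos.le hr0.le)
      ((div_lt_one hr0).2 hr.1)).mul_left C
  refine Summable.of_nonneg_of_le (fun n => mul_nonneg (inv_nonneg.2 (pow_pos hr0 _).le)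
    (levelSq_nonneg _ _)) (fun n => ?_) ((summable_nat_add_iff N).2 hgeo)
  refine (mul_le_mul_of_nonneg_left (h (n + N) (Nat.le_add_left N n))
    (inv_nonneg.2 (pow_pos hr0 _).le)).trans (le_of_eq ?_)
  rw [div_pow]
  ring

/-- At level `n` there are `O(ρ^(-n))` cells, each of diameter `O(ρ^n)`, so the level energy is
`O(ρ^n)`. -/
theorem isCore_of_lipschitz {K : NNReal} {g : V1bar W → ℝ} (hg : LipschitzWith K g) :
    IsCore (res W g) := by
  set A := K * (‖q 0‖ + ‖q 2‖)
  refine isCore_of_levelSq_le (C := 3 * A ^ 2 * (2 / rho ^ 2)) 0 fun n _ => ?_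
  have hdiff : ∀ {z z' : Plane} (hz : z ∈ V1 W) (hz' : z' ∈ V1 W),
      dist z z' ≤ (‖q 0‖ + ‖q 2‖) * rho ^ n →
      (res W g ⟨z, hz⟩ - res W g ⟨z', hz'⟩) ^ 2 ≤ (A * rho ^ n) ^ 2 := by
    intro z z' hz hz' hd
    have := hg.dist_le_mul ⟨z, subset_closure hz⟩ ⟨z', subset_closure hz'⟩
    rw [Real.dist_eq] at this
    refine sq_le_sq' ?_ ?_ <;> have h2 := mul_le_mul_of_nonneg_left hd K.2 <;>
      rw [abs_le] at this <;> rw [← mul_assoc] at h2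
    · exact (neg_le_neg h2).trans this.1
    · exact this.2.trans h2
  have hcell : ∀ p ∈ leftEnds n, cellSq (vals (res W g)) n p ≤
      3 * A ^ 2 * rho ^ n / rho ^ 2 * rho ^ (n + 2) := by
    intro p hp
    obtain ⟨h1, h2, h3⟩ := dist_pt_pt_succ n p
    have m1 := pt_mem_V1 W hp
    have m2 := pt_mem_V1 W (leftEnds_subset_succ hp)
    have m3 := pt_mem_V1 W (add_mem_leftEnds_succ hp)
    rw [cellSq, vals_eq _ m1, vals_eq _ m2, vals_eq _ m3]
    have e : 3 * A ^ 2 * rho ^ n / rho ^ 2 * rho ^ (n + 2) = 3 * (A * rho ^ n) ^ 2 := by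
      have := rho_pos.ne'
      field_simp
      ring
    rw [e]
    linarith [hdiff m1 m2 h1, hdiff m1 m3 h2, hdiff m2 m3 h3]
  refine (Finset.sum_le_sum hcell).trans ?_
  rw [← Finset.mul_sum]
  have hn := rho_pow_pos n
  have h2 := rho_pow_pos 2
  refine (mul_le_mul_of_nonneg_left (sum_rho_pow_le n) (by positivity)).trans (le_of_eq ?_)
  ring

/-- Data on a finite set are Lipschitz, and Lipschitz functions extend from any subset of a metric
space. -/
theorem exists_core_of_values (V : Finset (V1bar W)) (u : V1bar W → ℝ) :
    ∃ f : V1bar W → ℝ, Continuous f ∧ IsCore (res W f) ∧ ∀ x ∈ V, f x = u x := by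
  set K : ℝ := ∑ x ∈ V, ∑ y ∈ V, |u x - u y| / dist x y
  have hnn : ∀ x y, 0 ≤ |u x - u y| / dist x y := fun x y => by positivity
  have hlip : LipschitzOnWith K.toNNReal u V := by
    refine LipschitzOnWith.of_dist_le_mul fun x hx y hy => ?_
    rcases eq_or_ne x y with rfl | hne
    · simp
    · rw [Real.dist_eq, ← div_le_iff₀ (dist_pos.2 hne)]
      refine le_trans ?_ (Real.le_coe_toNNReal K)
      exact (Finset.single_le_sum (fun y _ => hnn x y) hy).trans
        (Finset.single_le_sum (f := fun x => ∑ y ∈ V, |u x - u y| / dist x y)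
          (fun x _ => Finset.sum_nonneg fun y _ => hnn x y) hx)
  obtain ⟨f, hf, hfu⟩ := hlip.extend_real
  exact ⟨f, hf.continuous, isCore_of_lipschitz hf, fun x hx => (hfu hx).symm⟩

theorem res_apply (f : V1bar W → ℝ) (x : V1 W) : res W f x = f (incl W x) := rfl

theorem psi_eq_of_add_const (f : V1 W → ℝ) (c : ℝ) :
    psi W r D (fun x => f x + c) (fun x => f x + c) = psi W r D f f :=
  tsum_congr fun w => psiTerm_add_const f c w

/-- The oscillation bound makes the sequence converge pointwise once it is normalized at `z₀`; lower
semicontinuity turns the Cauchy condition into convergence in energy. -/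
theorem complete_psiBar (hr : r ∈ Ioo rho 1) (f : ℕ → V1bar W → ℝ)
    (hf : ∀ n, f n ∈ psiBarDom W r D)
    (hC : ∀ ε > 0, ∃ N, ∀ m ≥ N, ∀ n ≥ N, psiBar W r D (f m - f n) (f m - f n) < ε) :
    ∃ g ∈ psiBarDom W r D, Tendsto (fun n => psiBar W r D (f n - g) (f n - g)) atTop (𝓝 0) := by
  have hr0 := pos_of_mem_Ioo_rho hr
  have hsub : ∀ f ∈ psiBarDom W r D, ∀ g ∈ psiBarDom W r D, f - g ∈ psiBarDom W r D := by
    intro f hf g hg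
    refine ⟨hf.1.sub hg.1, ?_⟩
    have := add_mem_psiDom hr0 hf.2 (smul_mem_psiDom (-1) hg.2)
    rwa [neg_one_smul, ← sub_eq_add_neg] at this
  obtain ⟨C, hC0, hb⟩ := exists_abs_sub_le (W := W) hr D
  let z₀ : V1bar W := incl W ⟨pt 0 0, pt_mem_V1 W (zero_mem_leftEnds 0)⟩
  have hlim : ∀ z, ∃ t, Tendsto (fun n => f n z - f n z₀) atTop (𝓝 t) := by
    intro z
    refine cauchySeq_tendsto_of_complete (Metric.cauchySeq_iff.2 fun ε hε => ?_)
    obtain ⟨N, hN⟩ := hC ((ε / (C + 1)) ^ 2) (by positivity)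
    refine ⟨N, fun m hm n hn => ?_⟩
    have h1 := hb _ (hsub _ (hf m) _ (hf n)) z z₀
    have h2 := Real.sqrt_lt_sqrt (psi_nonneg hr0 _) (hN m hm n hn)
    rw [Real.sqrt_sq (by positivity)] at h2
    rw [Real.dist_eq, sub_sub_sub_comm]
    refine h1.trans_lt ?_
    calc C * √(psiBar W r D (f m - f n) (f m - f n)) ≤ C * (ε / (C + 1)) :=
          mul_le_mul_of_nonneg_left h2.le hC0
      _ < (C + 1) * (ε / (C + 1)) := mul_lt_mul_of_pos_right (by linarith) (by positivity)
      _ = ε := by field_simp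
  choose G hG using hlim
  have hdiff : ∀ m ε, (∀ᶠ n in atTop, psiBar W r D (f m - f n) (f m - f n) ≤ ε) →
      res W (f m) - res W G ∈ psiDom W r D ∧
      psi W r D (res W (f m) - res W G) (res W (f m) - res W G) ≤ ε := by
    intro m ε hε
    -- Adding the constant `f n z₀` makes the differences converge pointwise and leaves their energy
    -- unchanged.
    refine psi_le_of_tendsto (l := atTop) (R := fun _ => r) (D' := fun _ => D)
      (h := fun n x => res W (f m - f n) x + f n z₀) hr0 tendsto_const_nhds tendsto_const_nhds
      (fun z => ?_) (hε.mono fun n hn => ⟨?_, ?_⟩)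
    · have := (hG (incl W z)).const_sub (f m (incl W z))
      refine this.congr fun n => ?_
      rw [res_apply, Pi.sub_apply]
      ring
    · exact (hsub _ (hf m) _ (hf n)).2.congr fun w => (psiTerm_add_const _ _ w).symm
    · rw [psi_eq_of_add_const]
      exact hn
  have hGdom : res W G ∈ psiDom W r D := by
    obtain ⟨N, hN⟩ := hC 1 one_pos
    have := (hdiff N 1 (eventually_atTop.2 ⟨N, fun n hn => (hN N le_rfl n hn).le⟩)).1
    have := add_mem_psiDom hr0 (hf N).2 (smul_mem_psiDom (-1) this)
    rwa [neg_one_smul, ← sub_eq_add_neg, sub_sub_cancel] at this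
  obtain ⟨g, ⟨hg, hgG⟩, -⟩ := exists_unique_extension (uniformContinuous_of_mem_psiDom hr hGdom)
  refine ⟨g, ⟨hg, hgG ▸ hGdom⟩, ?_⟩
  rw [Metric.tendsto_atTop]
  intro ε hε
  obtain ⟨N, hN⟩ := hC (ε / 2) (half_pos hε)
  refine ⟨N, fun m hm => ?_⟩
  have h1 := (hdiff m (ε / 2) (eventually_atTop.2 ⟨N, fun n hn => (hN m hm n hn).le⟩)).2
  have h2 : psiBar W r D (f m - g) (f m - g) =
      psi W r D (res W (f m) - res W G) (res W (f m) - res W G) := by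
    rw [← hgG]
    rfl
  rw [Real.dist_eq, sub_zero, h2, abs_of_nonneg (psi_nonneg hr0 _)]
  linarith

theorem isResistanceForm_psiBar (W : CellWords) (hr : r ∈ Ioo rho 1) (D : FormsV0) :
    IsResistanceForm (psiBarDom W r D) (psiBar W r D) := by
  have hr0 := pos_of_mem_Ioo_rho hr
  have hconst : ∀ (c : ℝ) (w : W.words), psiTerm W r D (fun _ => c) (fun _ => c) w = 0 := by
    intro c w
    simp [psiTerm, FormsV0.form_eq, cell]
  obtain ⟨C, hC0, hb⟩ := exists_abs_sub_le (W := W) hr D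
  have hbsq : ∀ f ∈ psiBarDom W r D, ∀ x y, |f x - f y| ^ 2 ≤ C ^ 2 * psiBar W r D f f := by
    intro f hf x y
    rw [← Real.sq_sqrt (show 0 ≤ psiBar W r D f f from psi_nonneg hr0 _), ← mul_pow]
    exact pow_le_pow_left₀ (abs_nonneg _) (hb f hf x y) 2
  refine ⟨fun c => ⟨continuous_const, ?_⟩, fun f hf g hg => ⟨hf.1.add hg.1, ?_⟩,
    fun c f hf => ⟨hf.1.const_smul c, smul_mem_psiDom c hf.2⟩, fun f hf g hg => ?_,
    fun f hf g hg k hk => ?_, fun c f hf g hg => ?_, fun f _ => psi_nonneg hr0 _,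
    fun f hf => ⟨fun h0 => ?_, ?_⟩, complete_psiBar hr, fun V u => ?_, fun x y _ => ⟨C ^ 2, ?_⟩,
    fun f hf => ?_⟩
  · exact summable_zero.congr fun w => (hconst c w).symm
  · exact add_mem_psiDom hr0 hf.2 hg.2
  · exact tsum_congr fun w => psiTerm_symm _ _ w
  · refine Eq.trans (tsum_congr fun w => psiTerm_add_left _ _ _ w) ?_
    exact (summable_psiTerm hr0 hf.2 hk.2).tsum_add (summable_psiTerm hr0 hg.2 hk.2)
  · exact (tsum_congr fun w => psiTerm_smul_left c _ _ w).trans tsum_mul_left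
  · let z₀ : V1bar W := incl W ⟨pt 0 0, pt_mem_V1 W (zero_mem_leftEnds 0)⟩
    refine ⟨f z₀, fun x => ?_⟩
    have := hb f hf x z₀
    rw [h0, Real.sqrt_zero, mul_zero] at this
    linarith [abs_eq_zero.1 (le_antisymm this (abs_nonneg _))]
  · rintro ⟨c, hc⟩
    obtain rfl : f = fun _ => c := funext hc
    exact (tsum_congr fun w => hconst c w).trans tsum_zero
  · obtain ⟨f, hf, hcore, hfu⟩ := exists_core_of_values V u
    exact ⟨f, ⟨hf, hcore r hr D⟩, hfu⟩
  · rintro _ ⟨f, hf, hpos, rfl⟩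
    exact (div_le_iff₀ hpos).2 (hbsq f hf x y)
  · have hle : ∀ w, psiTerm W r D (res W fun x => min (max (f x) 0) 1)
        (res W fun x => min (max (f x) 0) 1) w ≤ psiTerm W r D (res W f) (res W f) w := fun w =>
      mul_le_mul_of_nonneg_left (D.isResistanceForm.markov (cell W (res W f) w) trivial).2
        (zpow_pos hr0 _).le
    have hs := Summable.of_nonneg_of_le (fun w => psiTerm_nonneg hr0 _ w) hle hf.2
    exact ⟨⟨(hf.1.max continuous_const).min continuous_const, hs⟩, hs.tsum_le_tsum hle hf.2⟩

end

/-! ### Approximation by core functions -/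

section

variable {W : CellWords} {r : ℝ} {D : FormsV0}

open Classical in
/-- The function that agrees with `f` up to level `N` and interpolates its values of level `N`
linearly on the levels below. -/
def smoothing (f : V1 W → ℝ) (N : ℕ) (z : V1 W) : ℝ :=
  if rho ^ N ≤ height z then f z else interp N (vals f N) (leftPos z)

theorem vals_smoothing_of_le (f : V1 W → ℝ) {N n : ℕ} (h : n ≤ N) {p : ℝ} (hp : p ∈ leftEnds n) :
    vals (smoothing f N) n p = vals f n p := by
  rw [vals_eq _ (pt_mem_V1 W hp), vals_eq _ (pt_mem_V1 W hp), smoothing, if_pos]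
  rw [height_pt]
  exact pow_le_pow_of_le_one rho_pos.le rho_lt_one.le h

theorem vals_smoothing_of_ge (f : V1 W → ℝ) {N n : ℕ} (h : N ≤ n) {p : ℝ} (hp : p ∈ leftEnds n) :
    vals (smoothing f N) n p = interp N (vals f N) p := by
  rcases h.eq_or_lt with rfl | h
  · rw [vals_smoothing_of_le f le_rfl hp, interp_eq _ hp]
  · rw [vals_eq _ (pt_mem_V1 W hp), smoothing, if_neg, leftPos_pt]
    rw [height_pt, not_le]
    exact pow_lt_pow_right_of_lt_one₀ rho_pos rho_lt_one h

/-- From level `N` on the smoothing depends on the left end alone: in each cell one difference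
vanishes and the other two are equal up to sign, whence `16 = 2 · 8`. -/
theorem levelSq_smoothing_le (f : V1 W → ℝ) {N n : ℕ} (h : N ≤ n) :
    levelSq (vals (smoothing f N)) n ≤
      rho ^ n / rho ^ N * (16 * (levelSq (vals f) N + levelSq (vals f) (N + 1))) := by
  have hcell : levelSq (vals (smoothing f N)) n =
      2 * ∑ p ∈ leftEnds n,
        (interp N (vals f N) (p + rho ^ (n + 2)) - interp N (vals f N) p) ^ 2 := by
    rw [levelSq, Finset.mul_sum]
    refine Finset.sum_congr rfl fun p hp => ?_
    rw [cellSq, vals_smoothing_of_ge f h hp,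
      vals_smoothing_of_ge f (Nat.le_succ_of_le h) (leftEnds_subset_succ hp),
      vals_smoothing_of_ge f (Nat.le_succ_of_le h) (add_mem_leftEnds_succ hp)]
    ring
  have hpos : 0 ≤ rho ^ n / rho ^ N := div_nonneg (rho_pow_pos _).le (rho_pow_pos _).le
  rw [hcell]
  have h1 := sum_sq_interp_le N n (vals f N)
  have h2 := mul_le_mul_of_nonneg_left (sum_sq_inc_le (vals f) N) hpos
  linarith

theorem isCore_smoothing (f : V1 W → ℝ) (N : ℕ) : IsCore (smoothing f N) := by
  refine isCore_of_levelSq_le N (C := 16 * (levelSq (vals f) N + levelSq (vals f) (N + 1)) / rho ^ N)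
    fun n hn => (levelSq_smoothing_le f hn).trans (le_of_eq ?_)
  ring

theorem vals_sub (f g : V1 W → ℝ) {n : ℕ} {p : ℝ} (hp : p ∈ leftEnds n) :
    vals (f - g) n p = vals f n p - vals g n p := by
  simp only [vals_eq _ (pt_mem_V1 W hp), Pi.sub_apply]

theorem levelSq_sub_le (f g : V1 W → ℝ) (n : ℕ) :
    levelSq (vals (f - g)) n ≤ 2 * levelSq (vals f) n + 2 * levelSq (vals g) n := by
  rw [levelSq, levelSq, levelSq, Finset.mul_sum, Finset.mul_sum, ← Finset.sum_add_distrib]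
  refine Finset.sum_le_sum fun p hp => ?_
  simp only [cellSq, vals_sub f g hp, vals_sub f g (leftEnds_subset_succ hp),
    vals_sub f g (add_mem_leftEnds_succ hp)]
  have key : ∀ a b c d : ℝ, (a - b - (c - d)) ^ 2 ≤ 2 * (a - c) ^ 2 + 2 * (b - d) ^ 2 := by
    intro a b c d
    nlinarith [sq_nonneg (a - c + (b - d))]
  refine (add_le_add (add_le_add (key _ _ _ _) (key _ _ _ _)) (key _ _ _ _)).trans (le_of_eq ?_)
  ring

theorem levelSq_smoothing_sub_of_lt (f : V1 W → ℝ) {N n : ℕ} (h : n < N) :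
    levelSq (vals (smoothing f N - f)) n = 0 := by
  refine Finset.sum_eq_zero fun p hp => ?_
  have h1 := leftEnds_subset_succ hp
  have h2 := add_mem_leftEnds_succ hp
  simp only [cellSq, vals_sub _ f hp, vals_sub _ f h1, vals_sub _ f h2,
    vals_smoothing_of_le f h.le hp, vals_smoothing_of_le f (Nat.succ_le_of_lt h) h1,
    vals_smoothing_of_le f (Nat.succ_le_of_lt h) h2]
  ring

/-- The difference has no energy on levels below `N`. On the others it is bounded by a tail of the
convergent series `t` and by a geometric series of ratio `ρ / r` with factor `t N + t (N + 1)`, and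
both tend to `0`. -/
theorem tendsto_psi_smoothing_sub (hr : r ∈ Ioo rho 1) {f : V1 W → ℝ} (hf : f ∈ psiDom W r D) :
    Tendsto (fun N => psi W r D (smoothing f N - f) (smoothing f N - f)) atTop (𝓝 0) := by
  have hr0 := pos_of_mem_Ioo_rho hr
  obtain ⟨a, ha0, ha⟩ := D.eventually_coeff_le
  set t : ℕ → ℝ := fun n => (r ^ n)⁻¹ * levelSq (vals f) n
  have ht : Summable t := summable_levelSq hr0 hf
  have ht0 : ∀ n, 0 ≤ t n := fun n =>
    mul_nonneg (inv_nonneg.2 (pow_pos hr0 n).le) (levelSq_nonneg _ n)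
  set θ := rho / r
  have hθ0 : 0 ≤ θ := div_nonneg rho_pos.le hr0.le
  have hθ1 : θ < 1 := (div_lt_one hr0).2 hr.1
  have hgeo := summable_geometric_of_lt_one hθ0 hθ1
  have hbound : ∀ N, psi W r D (smoothing f N - f) (smoothing f N - f) ≤
      a * (32 * (t N + t (N + 1)) * (1 - θ)⁻¹ + 2 * ∑' k, t (k + N)) := by
    intro N
    set x : ℕ → ℝ := fun n => (r ^ n)⁻¹ * levelSq (vals (smoothing f N - f)) n
    have hx0 : ∀ n, 0 ≤ x n := fun n =>
      mul_nonneg (inv_nonneg.2 (pow_pos hr0 n).le) (levelSq_nonneg _ n)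
    have hsN : Summable fun k => t (k + N) := (summable_nat_add_iff N).2 ht
    have hsum : Summable fun k => 32 * (t N + t (N + 1)) * θ ^ k + 2 * t (k + N) :=
      (hgeo.mul_left _).add (hsN.mul_left 2)
    have hx : ∀ k, x (k + N) ≤ 32 * (t N + t (N + 1)) * θ ^ k + 2 * t (k + N) := by
      intro k
      have h1 := levelSq_sub_le (smoothing f N) f (k + N)
      have h2 := levelSq_smoothing_le f (Nat.le_add_left N k)
      have h3 : (r ^ (k + N))⁻¹ * (rho ^ (k + N) / rho ^ N *
          (16 * (levelSq (vals f) N + levelSq (vals f) (N + 1)))) =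
          16 * (t N + r * t (N + 1)) * θ ^ k := by
        simp only [t, θ, div_pow, pow_add]
        have := rho_pow_pos N
        have := hr0.ne'
        field_simp
      have h4 : 16 * (t N + r * t (N + 1)) * θ ^ k ≤ 16 * (t N + t (N + 1)) * θ ^ k := by
        refine mul_le_mul_of_nonneg_right ?_ (pow_nonneg hθ0 k)
        nlinarith [ht0 (N + 1), hr.2]
      have h5 := mul_le_mul_of_nonneg_left (h1.trans (add_le_add_left
        (mul_le_mul_of_nonneg_left h2 zero_le_two) _)) (inv_nonneg.2 (pow_pos hr0 (k + N)).le)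
      have h6 : (r ^ (k + N))⁻¹ * levelSq (vals f) (k + N) = t (k + N) := rfl
      rw [mul_add, mul_left_comm _ 2, h3, mul_left_comm _ 2, h6] at h5
      exact h5.trans (by linarith)
    have hxs : Summable fun k => x (k + N) :=
      Summable.of_nonneg_of_le (fun k => hx0 _) hx hsum
    have hxs' : Summable x := (summable_nat_add_iff N).1 hxs
    refine (psi_le_of_summable_levelSq hr0 ha.self_of_nhds hxs').2.trans
      (mul_le_mul_of_nonneg_left ?_ ha0.le)
    rw [← hxs'.sum_add_tsum_nat_add N, Finset.sum_eq_zero, zero_add]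
    · refine (hxs.tsum_le_tsum hx hsum).trans (le_of_eq ?_)
      rw [(hgeo.mul_left _).tsum_add (hsN.mul_left 2), tsum_mul_left, tsum_mul_left,
        tsum_geometric_of_lt_one hθ0 hθ1]
    · intro n hn
      simp only [x, levelSq_smoothing_sub_of_lt f (Finset.mem_range.1 hn), mul_zero]
  have hlim : Tendsto (fun N => a * (32 * (t N + t (N + 1)) * (1 - θ)⁻¹ + 2 * ∑' k, t (k + N)))
      atTop (𝓝 0) := by
    have h1 := ht.tendsto_atTop_zero
    have h2 := h1.comp (tendsto_add_atTop_nat 1)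
    have h3 := tendsto_sum_nat_add t
    have := (((((h1.add h2).const_mul 32).mul_const (1 - θ)⁻¹).add (h3.const_mul 2)).const_mul a)
    simpa using this
  exact squeeze_zero (fun N => psi_nonneg hr0 _) hbound hlim

/-- The vertices `q₀, q₁, q₂` as points of the closure of `V₁`. -/
def qBar (W : CellWords) (i : Fin 3) : V1bar W := ⟨q i, q_mem_closure W i⟩

theorem qBar_injective (W : CellWords) : Function.Injective (qBar W) := by
  intro i j h
  have h1 : q i = q j := congrArg Subtype.val h
  have h2 := congrArg (fun z : Plane => z 0) h1
  fin_cases i <;> fin_cases j <;> simp [q] at h2 ⊢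

theorem incl_pt_zero (W : CellWords) (h : pt 0 0 ∈ V1 W) : incl W ⟨pt 0 0, h⟩ = qBar W 0 :=
  Subtype.ext (by simp [incl, qBar, pt])

theorem IsResistanceForm.sqrt_add_le {X : Type*} {G : Set (X → ℝ)} {E : (X → ℝ) → (X → ℝ) → ℝ}
    (h : IsResistanceForm G E) {f g : X → ℝ} (hf : f ∈ G) (hg : g ∈ G) :
    √(E (f + g) (f + g)) ≤ √(E f f) + √(E g g) := by
  rw [Real.sqrt_le_left (by positivity), h.add_self hf hg, add_sq, Real.sq_sqrt (h.nonneg f hf),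
    Real.sq_sqrt (h.nonneg g hg), mul_assoc, ← Real.sqrt_mul (h.nonneg f hf)]
  have := Real.le_sqrt_of_sq_le (h.sq_le hf hg)
  linarith

/-- The trace on `V₀` is the infimum over functions that have finite energy for all parameters. -/
theorem exists_core_of_lt (hr : r ∈ Ioo rho 1) {f : V1bar W → ℝ} (hf : f ∈ psiBarDom W r D)
    {c : ℝ} (hc : psiBar W r D f f < c) :
    ∃ g : V1bar W → ℝ, Continuous g ∧ IsCore (res W g) ∧ (∀ i, g (qBar W i) = f (qBar W i)) ∧
      psiBar W r D g g < c := by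
  have hr0 := pos_of_mem_Ioo_rho hr
  have hE := isResistanceForm_psiBar W hr D
  obtain ⟨C, hC0, hb⟩ := exists_abs_sub_le (W := W) hr D
  have hbump : ∀ i : Fin 3, ∃ b : V1bar W → ℝ, Continuous b ∧ IsCore (res W b) ∧
      ∀ j, b (qBar W j) = Pi.single (M := fun _ => ℝ) i 1 j := by
    intro i
    obtain ⟨b, hbc, hbcore, hbv⟩ := exists_core_of_values (Finset.univ.image (qBar W))
      (Function.extend (qBar W) (Pi.single i 1) 0)
    refine ⟨b, hbc, hbcore, fun j => ?_⟩
    rw [hbv _ (Finset.mem_image_of_mem _ (Finset.mem_univ j)), (qBar_injective W).extend_apply]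
  choose b hbc hbcore hbv using hbump
  have hbG : ∀ i, b i ∈ psiBarDom W r D := fun i => ⟨hbc i, hbcore i r hr D⟩
  have hext : ∀ N, ∃ g : V1bar W → ℝ, Continuous g ∧ res W g = smoothing (res W f) N := by
    intro N
    obtain ⟨g, hg, -⟩ := exists_unique_extension
      (uniformContinuous_of_mem_psiDom hr (isCore_smoothing (res W f) N r hr D))
    exact ⟨g, hg⟩
  choose g hgc hgs using hext
  have hgcore : ∀ N, IsCore (res W (g N)) := fun N => hgs N ▸ isCore_smoothing (res W f) N
  have hgG : ∀ N, g N ∈ psiBarDom W r D := fun N => ⟨hgc N, hgcore N r hr D⟩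
  have hlim : Tendsto (fun N => √(psiBar W r D (g N - f) (g N - f))) atTop (𝓝 0) := by
    have := (tendsto_psi_smoothing_sub hr hf.2).sqrt
    rw [Real.sqrt_zero] at this
    refine this.congr fun N => ?_
    rw [← hgs]
    rfl
  have hd : ∀ N i, |f (qBar W i) - g N (qBar W i)| ≤ C * √(psiBar W r D (g N - f) (g N - f)) := by
    intro N i
    have h1 := hb _ (hE.sub_mem (hgG N) hf) (qBar W 0) (qBar W i)
    have h0 := zero_mem_leftEnds 0
    -- Smoothing never alters the value at `q₀`, the vertex of level `0`, so the oscillation bound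
    -- from `q₀` controls the errors at the other two vertices.
    have h2 : g N (qBar W 0) = f (qBar W 0) := by
      have := vals_smoothing_of_le (res W f) (Nat.zero_le N) h0
      rw [← hgs, vals_eq _ (pt_mem_V1 W h0), vals_eq _ (pt_mem_V1 W h0), res_apply,
        res_apply, incl_pt_zero] at this
      exact this
    simpa [h2] using h1
  set d : ℕ → Fin 3 → ℝ := fun N i => f (qBar W i) - g N (qBar W i)
  -- A combination of fixed core bumps restores the boundary values; its coefficients, hence its
  -- energy, tend to `0`.
  set k : ℕ → V1bar W → ℝ := fun N => d N 0 • b 0 + (d N 1 • b 1 + d N 2 • b 2)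
  have hsG : ∀ N i, d N i • b i ∈ psiBarDom W r D := fun N i => hE.smul_mem _ _ (hbG i)
  have hkG : ∀ N, k N ∈ psiBarDom W r D := fun N =>
    hE.add_mem _ (hsG N 0) _ (hE.add_mem _ (hsG N 1) _ (hsG N 2))
  have hsE : ∀ N i, √(psiBar W r D (d N i • b i) (d N i • b i)) ≤
      C * √(psiBar W r D (g N - f) (g N - f)) * √(psiBar W r D (b i) (b i)) := by
    intro N i
    have e : psiBar W r D (d N i • b i) (d N i • b i) = d N i ^ 2 * psiBar W r D (b i) (b i) := by
      rw [hE.smul_left _ _ (hbG i) _ (hsG N i), hE.symm _ (hbG i) _ (hsG N i),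
        hE.smul_left _ _ (hbG i) _ (hbG i)]
      ring
    rw [e, Real.sqrt_mul (sq_nonneg _), Real.sqrt_sq_eq_abs]
    exact mul_le_mul_of_nonneg_right (hd N i) (Real.sqrt_nonneg _)
  have hbound : ∀ N, √(psiBar W r D (g N + k N) (g N + k N)) ≤ √(psiBar W r D f f) +
      √(psiBar W r D (g N - f) (g N - f)) * (1 + C * (√(psiBar W r D (b 0) (b 0)) +
        √(psiBar W r D (b 1) (b 1)) + √(psiBar W r D (b 2) (b 2)))) := by
    intro N
    have h1 := hE.sqrt_add_le (hgG N) (hkG N)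
    have h2 := hE.sqrt_add_le hf (hE.sub_mem (hgG N) hf)
    have h3 := hE.sqrt_add_le (hsG N 0) (hE.add_mem _ (hsG N 1) _ (hsG N 2))
    have h4 := hE.sqrt_add_le (hsG N 1) (hsG N 2)
    rw [add_sub_cancel] at h2
    linarith [hsE N 0, hsE N 1, hsE N 2]
  have hlim2 := (hlim.mul_const (1 + C * (√(psiBar W r D (b 0) (b 0)) +
        √(psiBar W r D (b 1) (b 1)) + √(psiBar W r D (b 2) (b 2))))).const_add (√(psiBar W r D f f))
  rw [zero_mul, add_zero] at hlim2
  have hlt : √(psiBar W r D f f) < √c := Real.sqrt_lt_sqrt (hE.nonneg f hf) hc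
  obtain ⟨N, hN⟩ := (hlim2.eventually (gt_mem_nhds hlt)).exists
  refine ⟨g N + k N, (hgG N).1.add (hkG N).1, ?_, fun i => ?_, ?_⟩
  · exact (hgcore N).add (((hbcore 0).smul _).add (((hbcore 1).smul _).add ((hbcore 2).smul _)))
  · simp only [k, d, Pi.add_apply, Pi.smul_apply, smul_eq_mul, hbv]
    fin_cases i <;> simp
  · exact (Real.sqrt_lt_sqrt_iff (hE.nonneg _ (hE.add_mem _ (hgG N) _ (hkG N)))).1
      ((hbound N).trans_lt hN)

/-! ### Joint continuity of the trace -/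

theorem tendsto_psi_of_isCore {f : V1 W → ℝ} (hf : IsCore f) (x₀ : Ioo rho 1 × FormsV0) :
    Tendsto (fun x : Ioo rho 1 × FormsV0 => psi W x.1 x.2 f f) (𝓝 x₀)
      (𝓝 (psi W x₀.1 x₀.2 f f)) := by
  obtain ⟨⟨r, hr⟩, D⟩ := x₀
  have hr0 := pos_of_mem_Ioo_rho hr
  obtain ⟨c, hc, hD⟩ := D.exists_mul_sqForm_le
  obtain ⟨a, ha0, ha⟩ := D.eventually_coeff_le
  -- The dominating series is the energy at an exponent `s` strictly between `ρ` and `r`; it is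
  -- finite because `f` is in the core, and `r' > s` holds for all nearby `r'`.
  obtain ⟨s, hs, hsr⟩ := exists_between hr.1
  have hs0 := rho_pos.trans hs
  have h1 : Tendsto (fun x : Ioo rho 1 × FormsV0 => (x.1 : ℝ)) (𝓝 (⟨r, hr⟩, D)) (𝓝 r) :=
    (continuous_subtype_val.comp continuous_fst).tendsto _
  have h2 : Tendsto (fun x : Ioo rho 1 × FormsV0 => x.2) (𝓝 (⟨r, hr⟩, D)) (𝓝 D) :=
    continuous_snd.tendsto _
  refine tendsto_tsum_of_dominated_convergence
    (bound := fun w => a / c * psiTerm W s D f f w)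
    ((hf s ⟨hs, hsr.trans hr.2⟩ D).mul_left _)
    (fun w => tendsto_psiTerm (h := fun _ => f) hr0 h1 h2 (fun z => tendsto_const_nhds) w) ?_
  filter_upwards [h1.eventually (lt_mem_nhds hsr), h2.eventually ha] with x hx hxa w
  rw [Real.norm_of_nonneg (psiTerm_nonneg (hs0.trans hx) f w)]
  obtain ⟨k, rfl⟩ := (cellEquiv W).surjective w
  rw [psiTerm_cellEquiv, psiTerm_cellEquiv, mul_left_comm]
  have h3 := x.2.form_self_le hxa (cell W f (cellEquiv W k))
  have h4 : a * sqForm (cell W f (cellEquiv W k)) ≤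
      a / c * D.form (cell W f (cellEquiv W k)) (cell W f (cellEquiv W k)) := by
    rw [div_mul_eq_mul_div, le_div_iff₀ hc, mul_assoc, mul_comm _ c]
    exact mul_le_mul_of_nonneg_left (hD _) ha0.le
  exact mul_le_mul (inv_anti₀ (pow_pos hs0 _) (pow_le_pow_left₀ hs0.le hx.le _)) (h3.trans h4)
    (x.2.nonneg _) (inv_nonneg.2 (pow_pos hs0 _).le)

theorem traceV0_le (hr : r ∈ Ioo rho 1) {f : V1bar W → ℝ} (hf : f ∈ psiBarDom W r D)
    {u : Fin 3 → ℝ} (hu : ∀ i, f (qBar W i) = u i) :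
    traceV0 W (psiBarDom W r D) (psiBar W r D) u ≤ psiBar W r D f f := by
  refine csInf_le ⟨0, ?_⟩ ⟨f, hf, hu, rfl⟩
  rintro _ ⟨g, -, -, rfl⟩
  exact psi_nonneg (pos_of_mem_Ioo_rho hr) _

theorem exists_lt_of_traceV0_lt (hr : r ∈ Ioo rho 1) {u : Fin 3 → ℝ} {c : ℝ}
    (h : traceV0 W (psiBarDom W r D) (psiBar W r D) u < c) :
    ∃ f ∈ psiBarDom W r D, (∀ i, f (qBar W i) = u i) ∧ psiBar W r D f f < c := by
  obtain ⟨f₀, hf₀, hf₀u⟩ := (isResistanceForm_psiBar W hr D).exists_of_values (qBar_injective W) u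
  obtain ⟨_, ⟨f, hf, hfu, rfl⟩, hlt⟩ := exists_lt_of_csInf_lt
    (s := {t : ℝ | ∃ f ∈ psiBarDom W r D, (∀ i, f (qBar W i) = u i) ∧ t = psiBar W r D f f})
    ⟨_, f₀, hf₀, hf₀u, rfl⟩ h
  exact ⟨f, hf, hfu, hlt⟩

/-- A near-minimizer from the core remains a competitor at every parameter, and its energy varies
continuously. -/
theorem eventually_traceV0_lt {u : Fin 3 → ℝ} {c : ℝ} (x₀ : Ioo rho 1 × FormsV0)
    (h : traceV0 W (psiBarDom W x₀.1 x₀.2) (psiBar W x₀.1 x₀.2) u < c) :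
    ∀ᶠ x : Ioo rho 1 × FormsV0 in 𝓝 x₀,
      traceV0 W (psiBarDom W x.1 x.2) (psiBar W x.1 x.2) u < c := by
  obtain ⟨f, hf, hfu, hlt⟩ := exists_lt_of_traceV0_lt x₀.1.2 h
  obtain ⟨g, hg, hcore, hgv, hgE⟩ := exists_core_of_lt x₀.1.2 hf hlt
  filter_upwards [(tendsto_psi_of_isCore hcore x₀).eventually (gt_mem_nhds hgE)] with x hx
  exact (traceV0_le x.1.2 ⟨hg, hcore x.1 x.1.2 x.2⟩ fun i => (hgv i).trans (hfu i)).trans_lt hx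

/-- If the trace stayed at most `c` along an ultrafilter converging to `x₀`, near-minimizers of
energy below `K` would have a pointwise limit on `V₁`, of energy at most `K` and with boundary
values `u`, contradicting that `K` lies below the trace at `x₀`. -/
theorem eventually_lt_traceV0 {u : Fin 3 → ℝ} {c : ℝ} (x₀ : Ioo rho 1 × FormsV0)
    (h : c < traceV0 W (psiBarDom W x₀.1 x₀.2) (psiBar W x₀.1 x₀.2) u) :
    ∀ᶠ x : Ioo rho 1 × FormsV0 in 𝓝 x₀,
      c < traceV0 W (psiBarDom W x.1 x.2) (psiBar W x.1 x.2) u := by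
  obtain ⟨K, hcK, hK⟩ := exists_between h
  by_contra hne
  rw [not_eventually, frequently_iff_neBot] at hne
  obtain ⟨U, hU⟩ := @Ultrafilter.exists_le _ _ hne
  have hU₁ : (U : Filter _) ≤ 𝓝 x₀ := hU.trans inf_le_left
  have hU₂ : ∀ᶠ x : Ioo rho 1 × FormsV0 in U,
      ¬ c < traceV0 W (psiBarDom W x.1 x.2) (psiBar W x.1 x.2) u := hU.trans inf_le_right
      (mem_principal_self _)
  have hex : ∀ x : Ioo rho 1 × FormsV0, ∃ f : V1bar W → ℝ,
      ¬ c < traceV0 W (psiBarDom W x.1 x.2) (psiBar W x.1 x.2) u →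
      f ∈ psiBarDom W x.1 x.2 ∧ (∀ i, f (qBar W i) = u i) ∧ psiBar W x.1 x.2 f f < K := by
    intro x
    by_cases hx : c < traceV0 W (psiBarDom W x.1 x.2) (psiBar W x.1 x.2) u
    · exact ⟨0, fun h => absurd hx h⟩
    · obtain ⟨f, hf⟩ := exists_lt_of_traceV0_lt x.1.2 ((not_lt.1 hx).trans_lt hcK)
      exact ⟨f, fun _ => hf⟩
  choose f hf using hex
  obtain ⟨⟨r, hr⟩, D⟩ := x₀
  have hr0 := pos_of_mem_Ioo_rho hr
  obtain ⟨r₁, hrr₁, hr₁⟩ := exists_between hr.2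
  obtain ⟨a, ha, hD⟩ := D.eventually_mul_sqForm_le
  have h1 : Tendsto (fun x : Ioo rho 1 × FormsV0 => (x.1 : ℝ)) U (𝓝 r) :=
    ((continuous_subtype_val.comp continuous_fst).tendsto _).mono_left hU₁
  have h2 : Tendsto (fun x : Ioo rho 1 × FormsV0 => x.2) U (𝓝 D) :=
    (continuous_snd.tendsto _).mono_left hU₁
  set B := √(K / a)
  set s := √r₁
  have hev : ∀ᶠ x in (U : Filter _), f x ∈ psiBarDom W x.1 x.2 ∧ (∀ i, f x (qBar W i) = u i) ∧
      psiBar W x.1 x.2 (f x) (f x) < K ∧ ChildBound (vals (res W (f x))) B s := by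
    filter_upwards [hU₂, h1.eventually (gt_mem_nhds hrr₁), h2.eventually hD] with x hx hxr hxD
    obtain ⟨hx1, hx2, hx3⟩ := hf x hx
    exact ⟨hx1, hx2, hx3, childBound_of_psi_le (pos_of_mem_Ioo_rho x.1.2) hxr.le hr₁ ha hxD hx1.2
      hx3.le⟩
  have hlim : ∀ z, ∃ t, Tendsto (fun x => res W (f x) z) U (𝓝 t) := by
    intro z
    have hIcc : ∀ᶠ x in (U : Filter _),
        res W (f x) z ∈ Icc (u 0 - 2 * B / (1 - s)) (u 0 + 2 * B / (1 - s)) := by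
      filter_upwards [hev] with x hx
      have := hx.2.2.2.abs_sub_le hx.1.1 (incl W z) (qBar W 0)
      rw [hx.2.1 0, abs_le] at this
      rw [res_apply]
      constructor <;> linarith [this.1, this.2]
    obtain ⟨t, -, ht⟩ := isCompact_Icc.ultrafilter_le_nhds (U.map fun x => res W (f x) z)
      (le_principal_iff.2 hIcc)
    exact ⟨t, ht⟩
  choose f₀ hf₀ using hlim
  obtain ⟨hdom, hE⟩ := psi_le_of_tendsto (K := K) hr0 h1 h2 hf₀
    (hev.mono fun x hx => ⟨hx.1.2, hx.2.2.1.le⟩)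
  obtain ⟨g, ⟨hg, hgf⟩, -⟩ := exists_unique_extension (uniformContinuous_of_mem_psiDom hr hdom)
  -- Pointwise limits on `V₁` say nothing directly about `q₁` and `q₂`, which are not in `V₁`; a
  -- rate of approach common to all `f x` carries the boundary values to the limit.
  obtain ⟨z, hz, hzb⟩ := exists_approx_q W
  set M := B * (2 / (1 - s) + 8 / rho ^ 2)
  have hgz : ∀ i n, |g (incl W (z i n)) - u i| ≤ M * s ^ n := by
    intro i n
    rw [← res_apply g, hgf]
    refine le_of_tendsto ((hf₀ (z i n)).sub_const (u i)).abs ?_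
    filter_upwards [hev] with x hx
    refine le_of_tendsto (x := atTop) (f := fun m => |res W (f x) (z i n) - res W (f x) (z i m)|) ?_
      (eventually_atTop.2 ⟨n, fun m hm => hzb _ B s hx.2.2.2 i n m hm⟩)
    rw [← hx.2.1 i]
    exact (((hx.1.1.tendsto _).comp (hz i)).const_sub _).abs
  have hs1 : s < 1 := by
    rw [Real.sqrt_lt' one_pos]
    linarith
  have hgq : ∀ i, g (qBar W i) = u i := by
    intro i
    have h3 : Tendsto (fun n => |g (incl W (z i n)) - u i|) atTop (𝓝 |g (qBar W i) - u i|) :=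
      (((hg.tendsto _).comp (hz i)).sub_const _).abs
    have h4 : Tendsto (fun n => M * s ^ n) atTop (𝓝 (M * 0)) :=
      (tendsto_pow_atTop_nhds_zero_of_lt_one (Real.sqrt_nonneg _) hs1).const_mul M
    rw [mul_zero] at h4
    have h5 := le_of_tendsto_of_tendsto' h3 h4 (hgz i)
    linarith [abs_eq_zero.1 (le_antisymm h5 (abs_nonneg _))]
  have hle := traceV0_le (D := D) hr ⟨hg, hgf ▸ hdom⟩ hgq
  rw [psiBar, hgf] at hle
  exact absurd (hK.trans_le hle) (not_lt.2 hE)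

theorem continuous_traceV0 (W : CellWords) (u : Fin 3 → ℝ) :
    Continuous fun x : Ioo rho 1 × FormsV0 =>
      traceV0 W (psiBarDom W x.1 x.2) (psiBar W x.1 x.2) u :=
  continuous_iff_continuousAt.2 fun x₀ => tendsto_order.2
    ⟨fun _ h => eventually_lt_traceV0 x₀ h, fun _ h => eventually_traceV0_lt x₀ h⟩

/-- The conductances are values of the bilinear form, recovered from the quadratic form by
polarization. -/
theorem FormsV0.continuous_of_continuous_form {X : Type*} [TopologicalSpace X] {R : X → FormsV0}
    (h : ∀ u, Continuous fun x => (R x).form u u) : Continuous R := by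
  have hpol : ∀ u v, Continuous fun x => -(R x).form u v := by
    intro u v
    have e : ∀ x, -(R x).form u v =
        ((R x).form u u + (R x).form v v - (R x).form (u + v) (u + v)) / 2 := by
      intro x
      rw [(R x).isResistanceForm.add_self (f := u) (g := v) trivial trivial]
      ring
    simp only [e]
    exact (((h u).add (h v)).sub (h (u + v))).div_const 2
  refine continuous_induced_rng.2 (continuous_pi fun i => ?_)
  fin_cases i
  · exact hpol (Pi.single 0 1) (Pi.single 1 1)
  · exact hpol (Pi.single 0 1) (Pi.single 2 1)
  · exact hpol (Pi.single 1 1) (Pi.single 2 1)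

end

end GoldenGasket

end

theorem theorem4p1 (W : CellWords) :
    (∀ r ∈ Set.Ioo rho 1, ∀ D : FormsV0,
      (∀ f ∈ psiDom W r D, ∃! g : V1bar W → ℝ, Continuous g ∧ res W g = f) ∧
      IsResistanceForm (psiBarDom W r D) (psiBar W r D)) ∧
    ∃ R : Set.Ioo rho 1 × FormsV0 → FormsV0,
      (∀ (r : Set.Ioo rho 1) (D : FormsV0) (u : Fin 3 → ℝ),
        (R (r, D)).form u u = traceV0 W (psiBarDom W r D) (psiBar W r D) u) ∧
      Continuous R := by
  refine ⟨fun r hr D => ⟨fun f hf => exists_unique_extension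
    (uniformContinuous_of_mem_psiDom hr hf), isResistanceForm_psiBar W hr D⟩, ?_⟩
  have htrace : ∀ x : Set.Ioo rho 1 × FormsV0, ∃ D' : FormsV0,
      ∀ u, D'.form u u = traceV0 W (psiBarDom W x.1 x.2) (psiBar W x.1 x.2) u := by
    intro x
    obtain ⟨E', hE', h⟩ :=
      (isResistanceForm_psiBar W x.1.2 x.2).exists_trace (qBar_injective W)
    exact ⟨⟨E', hE'⟩, h⟩
  choose R hR using htrace
  refine ⟨R, fun r D u => hR (r, D) u, FormsV0.continuous_of_continuous_form fun u => ?_⟩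
  simpa only [hR] using continuous_traceV0 W u
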